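/- Let $(\mathcal A,G,\alpha)$ be a free C$^*$-dynamical system with $\mathcal A$ a unital C$^*$-algebra and $G$ a compact (Hausdorff) group (strongly continuous action, Ellwood map $\mathcal A\otimes_{\mathrm{alg}}\mathcal A\to C(G,\mathcal A)$, $x\otimes y\mapsto(g\mapsto x\,\alpha_g(y))$, of dense range), and let $1\to Z\xrightarrow{\iota}\hat G\xrightarrow{q}G\to1$ be a central extension of compact groups, with Pontryagin dual $Z^*$ of $Z$ written additively. A $\hat G$-structure is a free C$^*$-dynamical system $(\hat{\mathcal A},\hat G,\hat\alpha)$ with $\hat{\mathcal A}^Z=\mathcal A$ and $\hat\alpha_{\hat g}|_{\mathcal A}=\alpha_{q(\hat g)}$; two are equivalent if there is a $\hat G$-equivariant $*$-isomorphism between them restricting to the identity on $\mathcal A$. Let $\mathrm{Pic}_{\hat G}(\mathcal A)$ be the group, under $\otimes_{\mathcal A}$, of equivalence classes of Morita self-equivalences over $(\mathcal A,\hat G,\alpha\circ q)$, i.e. of Morita equivalence $\mathcal A$-bimodules with a strongly continuous $\hat G$-action by linear automorphisms compatible with both inner products; equivalence means $\hat G$-equivariant bimodule isomorphism preserving both inner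 products. The $Z$-isotypic components $\hat A(\chi)=\{x\in\hat{\mathcal A}:\hat\alpha_{\iota(z)}(x)=\chi(z)x\ \forall z\in Z\}$, with inner products $xy^*$ and $x^*y$, are Morita self-equivalences, and $\chi\mapsto[\hat A(\chi)]$ is a homomorphism $\mathsf p_{\hat{\mathcal A}}\colon Z^*\to\mathrm{Pic}_{\hat G}(\mathcal A)$, the Picard homomorphism of the $\hat G$-structure. Let $\mathsf p\colon Z^*\to\mathrm{Pic}_{\hat G}(\mathcal A)$ be a group homomorphism such that the set $\mathrm{Ext}(\hat G,(\mathcal A,G,\alpha),\mathsf p)$ of equivalence classes of $\hat G$-structures with Picard homomorphism $\mathsf p$ is non-empty. For each $\chi\in Z^*$ fix a representative $M(\chi)$ of $\mathsf p(\chi)$, with $M(0)=\mathcal A$. Let $\mathcal U(Z(\mathcal A)^G)$ be the group of $G$-invariant unitaries in the center of $\mathcal A$, and let $\Delta\colon Z^*\to\mathrm{Aut}(\mathcal U(Z(\mathcal A)^G))$ be the homomorphism determined by $\Delta_\chi(u)x=xu$ for all $x\in M(\chi)$. Say that a $\hat G$-structure has $Z$-isotypic components $M(\chi)$, $\chi\in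 Z^*$, if it comes with identifications $\hat A(\chi)=M(\chi)$ of Morita self-equivalences for all $\chi$, the one for $\chi=0$ being the identity of $\mathcal A$; its multiplication then induces maps $m_{(\chi,\chi')}\colon M(\chi)\otimes_{\mathcal A}M(\chi')\to M(\chi+\chi')$. Then: 1. Each class in $\mathrm{Ext}(\hat G,(\mathcal A,G,\alpha),\mathsf p)$ is represented by a $\hat G$-structure with $Z$-isotypic components $M(\chi)$, $\chi\in Z^*$; and each $\hat G$-structure with these $Z$-isotypic components represents a class in this set. 2. For any two $\hat G$-structures with $Z$-isotypic components $M(\chi)$, $\chi\in Z^*$, with multiplication maps $m$ and $m'$, there is a unique map $\omega\colon Z^*\times Z^*\to\mathcal U(Z(\mathcal A)^G)$ with $m'_{(\chi,\chi')}=\omega(\chi,\chi')\,m_{(\chi,\chi')}$ for all $\chi,\chi'\in Z^*$, and $\omega$ is a (normalized) $2$-cocycle, $\omega\in Z^2_\Delta(Z^*,\mathcal U(Z(\mathcal A)^G))$. 3. Two $\hat G$-structures with $Z$-isotypic components $M(\chi)$, $\chi\in Z^*$, represent the same class in $\mathrm{Ext}(\hat G,(\mathcal A,G,\alpha),\mathsf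 p)$ if and only if the $2$-cocycle $\omega$ of item 2 is a coboundary, i.e. $\omega\in B^2_\Delta(Z^*,\mathcal U(Z(\mathcal A)^G))$. -/

import Mathlib

open scoped TensorProduct
open MulOpposite

universe u

namespace CStarLift

/-! ## C*-dynamical systems and freeness -/

/-- A C*-dynamical system `(A, G, α)`: a strongly continuous action of `G` on the unital
C*-algebra `A` by *-automorphisms. -/
structure CStarSystem (G : Type*) [Group G] [TopologicalSpace G] (A : Type*) [CStarAlgebra A] where
  act : G →* (A ≃⋆ₐ[ℂ] A)
  continuous_act : ∀ a : A, Continuous fun g => act g a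

namespace CStarSystem

variable {G : Type*} [Group G] [TopologicalSpace G] {A : Type*} [CStarAlgebra A]

/-- The Ellwood map `A ⊗ A → C(G, A)`, `x ⊗ y ↦ (g ↦ x α_g(y))` on the algebraic tensor product. -/
noncomputable def ellwoodMap (α : CStarSystem G A) : A ⊗[ℂ] A →ₗ[ℂ] C(G, A) :=
  TensorProduct.lift <| LinearMap.mk₂ ℂ
    (fun x y => (⟨fun g => x * α.act g y, continuous_const.mul (α.continuous_act y)⟩ : C(G, A)))
    (fun x x' y => by ext g; simp [add_mul])
    (fun c x y => by ext g; simp)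
    (fun x y y' => by ext g; simp [mul_add])
    (fun c x y => by ext g; simp)

/-- Freeness in the sense of Ellwood: the Ellwood map has dense range. For compact `G` the topology
of `C(G, A)` is the one of its C*-norm. -/
def IsFree (α : CStarSystem G A) : Prop :=
  Dense (Set.range α.ellwoodMap)

/-- The system `(A, H, α ∘ q)` for a continuous homomorphism `q : H → G`. -/
def pullback {H : Type*} [Group H] [TopologicalSpace H] (α : CStarSystem G A) (q : H →ₜ* G) :
    CStarSystem H A where
  act := α.act.comp q
  continuous_act a := (α.continuous_act a).comp q.continuous_toFun

/-- The group `U(Z(A)^G)` of `G`-invariant unitaries in the center of `A`. -/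
def centralUnitary (α : CStarSystem G A) : Subgroup (unitary A) where
  carrier := {w | (∀ a : A, (w : A) * a = a * w) ∧ ∀ g, α.act g (w : A) = w}
  one_mem' := by simp
  mul_mem' := by
    rintro x y ⟨hx, hx'⟩ ⟨hy, hy'⟩
    refine ⟨fun a => ?_, fun g => by simp [hx', hy']⟩
    simp only [Submonoid.coe_mul]
    rw [mul_assoc, hy, ← mul_assoc, hx, mul_assoc]
  inv_mem' := by
    rintro x ⟨hx, hx'⟩
    refine ⟨fun a => ?_, fun g => ?_⟩
    · have h := congrArg star (hx (star a))
      simp only [star_mul, star_star] at h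
      simpa [← Unitary.star_eq_inv] using h.symm
    · simp [← Unitary.star_eq_inv, map_star, hx']

instance (α : CStarSystem G A) : CommGroup α.centralUnitary :=
  { (inferInstance : Group α.centralUnitary) with
    mul_comm := fun x y => by
      apply Subtype.ext; apply Subtype.ext
      exact x.2.1 _ }

/-- The invariants under `α ∘ q` are those under `α` when `q` is onto. -/
theorem centralUnitary_pullback {H : Type*} [Group H] [TopologicalSpace H] (α : CStarSystem G A)
    (q : H →ₜ* G) (hq : Function.Surjective q) :
    (α.pullback q).centralUnitary = α.centralUnitary := by
  ext w
  refine and_congr_right fun _ => ⟨fun h g => ?_, fun h x => h (q x)⟩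
  obtain ⟨x, rfl⟩ := hq g
  exact h x

end CStarSystem

/-! ## Morita self-equivalences and the equivariant Picard group -/

section Morita

variable {H : Type*} [Group H] [TopologicalSpace H] {A : Type u} [CStarAlgebra A]

/-- A Morita self-equivalence over `(A, H, β)`: a Morita equivalence (imprimitivity) `A`-bimodule,
that is, a full left and full right Hilbert `A`-module whose two inner products are compatible,
together with a strongly continuous action of `H` by linear automorphisms that is compatible with
both inner products. The left action of `a` is `left a`, the right one is `right (op a)`;
`linner` is linear in the first and `rinner` in the second variable. -/
structure MoritaSelfEquivalence (β : CStarSystem H A) where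
  carrier : Type u
  [normedAddCommGroup : NormedAddCommGroup carrier]
  [normedSpace : NormedSpace ℂ carrier]
  [completeSpace : CompleteSpace carrier]
  left : A →ₐ[ℂ] Module.End ℂ carrier
  right : Aᵐᵒᵖ →ₐ[ℂ] Module.End ℂ carrier
  left_right : ∀ a b x, left a (right b x) = right b (left a x)
  linner : carrier → carrier → A
  rinner : carrier → carrier → A
  linner_add : ∀ x y z, linner (x + y) z = linner x z + linner y z
  linner_left : ∀ a x y, linner (left a x) y = a * linner x y
  star_linner : ∀ x y, star (linner x y) = linner y x
  linner_self : ∀ x, ∃ a, linner x x = star a * a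
  rinner_add : ∀ x y z, rinner x (y + z) = rinner x y + rinner x z
  rinner_right : ∀ a x y, rinner x (right (op a) y) = rinner x y * a
  star_rinner : ∀ x y, star (rinner x y) = rinner y x
  rinner_self : ∀ x, ∃ a, rinner x x = star a * a
  norm_linner : ∀ x, ‖linner x x‖ = ‖x‖ ^ 2
  norm_rinner : ∀ x, ‖rinner x x‖ = ‖x‖ ^ 2
  linner_right : ∀ a x y, linner (right (op a) x) y = linner x (right (op (star a)) y)
  rinner_left : ∀ a x y, rinner (left a x) y = rinner x (left (star a) y)
  left_linner : ∀ x y z, left (linner x y) z = right (op (rinner y z)) x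
  linner_full : Dense (Submodule.span ℂ {a | ∃ x y, linner x y = a} : Set A)
  rinner_full : Dense (Submodule.span ℂ {a | ∃ x y, rinner x y = a} : Set A)
  act : H →* (carrier ≃ₗ[ℂ] carrier)
  continuous_act : ∀ x, Continuous fun h => act h x
  linner_act : ∀ h x y, linner (act h x) (act h y) = β.act h (linner x y)
  rinner_act : ∀ h x y, rinner (act h x) (act h y) = β.act h (rinner x y)

namespace MoritaSelfEquivalence

attribute [instance] normedAddCommGroup normedSpace completeSpace

variable {β : CStarSystem H A}

instance : CoeSort (MoritaSelfEquivalence β) (Type u) := ⟨carrier⟩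

/-- An equivalence of Morita self-equivalences: an `H`-equivariant `A`-bimodule isomorphism
that preserves both inner products. -/
structure Iso (M N : MoritaSelfEquivalence β) where
  toEquiv : M ≃ₗ[ℂ] N
  map_left : ∀ a x, toEquiv (M.left a x) = N.left a (toEquiv x)
  map_right : ∀ a x, toEquiv (M.right a x) = N.right a (toEquiv x)
  map_linner : ∀ x y, N.linner (toEquiv x) (toEquiv y) = M.linner x y
  map_rinner : ∀ x y, N.rinner (toEquiv x) (toEquiv y) = M.rinner x y
  map_act : ∀ h x, toEquiv (M.act h x) = N.act h (toEquiv x)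

instance {M N : MoritaSelfEquivalence β} : CoeFun (Iso M N) (fun _ => M → N) :=
  ⟨fun e => e.toEquiv⟩

/-- The identity. -/
def Iso.refl (M : MoritaSelfEquivalence β) : Iso M M where
  toEquiv := LinearEquiv.refl ℂ M
  map_left _ _ := rfl
  map_right _ _ := rfl
  map_linner _ _ := rfl
  map_rinner _ _ := rfl
  map_act _ _ := rfl

/-- The inverse. -/
def Iso.symm {M N : MoritaSelfEquivalence β} (e : Iso M N) : Iso N M where
  toEquiv := e.toEquiv.symm
  map_left a x := by rw [LinearEquiv.symm_apply_eq, e.map_left, LinearEquiv.apply_symm_apply]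
  map_right a x := by rw [LinearEquiv.symm_apply_eq, e.map_right, LinearEquiv.apply_symm_apply]
  map_linner x y := by rw [← e.map_linner]; simp
  map_rinner x y := by rw [← e.map_rinner]; simp
  map_act h x := by rw [LinearEquiv.symm_apply_eq, e.map_act, LinearEquiv.apply_symm_apply]

/-- The composition. -/
def Iso.trans {M N P : MoritaSelfEquivalence β} (e : Iso M N) (f : Iso N P) : Iso M P where
  toEquiv := e.toEquiv.trans f.toEquiv
  map_left a x := by simp [e.map_left, f.map_left]
  map_right a x := by simp [e.map_right, f.map_right]
  map_linner x y := by simp [e.map_linner, f.map_linner]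
  map_rinner x y := by simp [e.map_rinner, f.map_rinner]
  map_act h x := by simp [e.map_act, f.map_act]

instance setoid (β : CStarSystem H A) : Setoid (MoritaSelfEquivalence β) where
  r M N := Nonempty (Iso M N)
  iseqv :=
    { refl := fun M => ⟨Iso.refl M⟩
      symm := fun ⟨e⟩ => ⟨e.symm⟩
      trans := fun ⟨e⟩ ⟨f⟩ => ⟨e.trans f⟩ }

/-- `P`, with the balanced map `t`, is the internal tensor product `M ⊗_A N`: the elementary
tensors `t x y` span a dense subspace of `P`, and the bimodule structure, both inner products and
the action of `H` are on elementary tensors those of `M ⊗_A N`. -/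
structure IsInternalTensor (M N P : MoritaSelfEquivalence β) (t : M →ₗ[ℂ] N →ₗ[ℂ] P) : Prop where
  balanced : ∀ a x y, t (M.right (op a) x) y = t x (N.left a y)
  left_apply : ∀ a x y, P.left a (t x y) = t (M.left a x) y
  right_apply : ∀ a x y, P.right a (t x y) = t x (N.right a y)
  act_apply : ∀ h x y, P.act h (t x y) = t (M.act h x) (N.act h y)
  linner_apply : ∀ x y x' y',
    P.linner (t x y) (t x' y') = M.linner (M.right (op (N.linner y y')) x) x'
  rinner_apply : ∀ x y x' y',
    P.rinner (t x y) (t x' y') = N.rinner y (N.left (M.rinner x x') y')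
  dense_span : Dense (Submodule.span ℂ {p | ∃ x y, t x y = p} : Set P)

/-! ### The automorphism `Δ_M` of `U(Z(A)^H)` -/

variable (M : MoritaSelfEquivalence β)

theorem exists_unit_linner :
    ∃ s : Aˣ, (s : A) ∈ Submodule.span ℂ {a | ∃ x y, M.linner x y = a} := by
  obtain ⟨_, ⟨s, rfl⟩, ha⟩ :=
    M.linner_full.inter_open_nonempty _ (Units.isOpen (R := A)) ⟨1, isUnit_one⟩
  exact ⟨s, ha⟩

theorem exists_unit_rinner :
    ∃ s : Aˣ, (s : A) ∈ Submodule.span ℂ {a | ∃ x y, M.rinner x y = a} := by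
  obtain ⟨_, ⟨s, rfl⟩, ha⟩ :=
    M.rinner_full.inter_open_nonempty _ (Units.isOpen (R := A)) ⟨1, isUnit_one⟩
  exact ⟨s, ha⟩

theorem eq_of_mul_linner {a b : A} (h : ∀ x y, a * M.linner x y = b * M.linner x y) : a = b := by
  obtain ⟨s, hs⟩ := M.exists_unit_linner
  have : ∀ c ∈ Submodule.span ℂ {a | ∃ x y, M.linner x y = a}, a * c = b * c := by
    intro c hc
    induction hc using Submodule.span_induction with
    | mem c hc => obtain ⟨x, y, rfl⟩ := hc; exact h x y
    | zero => simp
    | add c d _ _ hc hd => rw [mul_add, mul_add, hc, hd]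
    | smul z c _ hc => rw [mul_smul_comm, mul_smul_comm, hc]
  exact s.isUnit.mul_right_cancel (this s hs)

theorem eq_of_rinner_mul {a b : A} (h : ∀ x y, M.rinner x y * a = M.rinner x y * b) : a = b := by
  obtain ⟨s, hs⟩ := M.exists_unit_rinner
  have : ∀ c ∈ Submodule.span ℂ {a | ∃ x y, M.rinner x y = a}, c * a = c * b := by
    intro c hc
    induction hc using Submodule.span_induction with
    | mem c hc => obtain ⟨x, y, rfl⟩ := hc; exact h x y
    | zero => simp
    | add c d _ _ hc hd => rw [add_mul, add_mul, hc, hd]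
    | smul z c _ hc => rw [smul_mul_assoc, smul_mul_assoc, hc]
  exact s.isUnit.mul_left_cancel (this s hs)

theorem left_faithful {a b : A} (h : ∀ x, M.left a x = M.left b x) : a = b :=
  M.eq_of_mul_linner fun x y => by rw [← M.linner_left, ← M.linner_left, h]

theorem right_faithful {a b : A} (h : ∀ x, M.right (op a) x = M.right (op b) x) : a = b :=
  M.eq_of_rinner_mul fun x y => by rw [← M.rinner_right, ← M.rinner_right, h]

theorem linner_add' (x y z : M) : M.linner x (y + z) = M.linner x y + M.linner x z := by
  rw [← M.star_linner, M.linner_add, star_add, M.star_linner, M.star_linner]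

theorem rinner_add' (x y z : M) : M.rinner (x + y) z = M.rinner x z + M.rinner y z := by
  rw [← M.star_rinner, M.rinner_add, star_add, M.star_rinner, M.star_rinner]

theorem ext_rinner {x y : M} (h : ∀ w, M.rinner w x = M.rinner w y) : x = y := by
  have h1 := h (x - y)
  have h2 := M.rinner_add (x - y) (x - y) y
  rw [sub_add_cancel, h1, right_eq_add] at h2
  have h3 := M.norm_rinner (x - y)
  rw [h2, norm_zero] at h3
  have h4 : ‖x - y‖ = 0 := by simpa using h3.symm
  exact sub_eq_zero.mp (norm_eq_zero.mp h4)

theorem ext_linner {x y : M} (h : ∀ w, M.linner x w = M.linner y w) : x = y := by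
  have h1 := h (x - y)
  have h2 := M.linner_add (x - y) y (x - y)
  rw [sub_add_cancel, h1, right_eq_add] at h2
  have h3 := M.norm_linner (x - y)
  rw [h2, norm_zero] at h3
  have h4 : ‖x - y‖ = 0 := by simpa using h3.symm
  exact sub_eq_zero.mp (norm_eq_zero.mp h4)

theorem act_act_inv (h : H) (x : M) : M.act h (M.act h⁻¹ x) = x := by
  rw [← LinearEquiv.mul_apply, ← map_mul, mul_inv_cancel, map_one]; rfl

theorem act_right (h : H) (a : A) (x : M) :
    M.act h (M.right (op a) x) = M.right (op (β.act h a)) (M.act h x) := by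
  refine M.ext_rinner fun w => ?_
  rw [← M.act_act_inv h w, M.rinner_act, M.rinner_right, M.rinner_right, M.rinner_act, map_mul]

theorem act_left (h : H) (a : A) (x : M) :
    M.act h (M.left a x) = M.left (β.act h a) (M.act h x) := by
  refine M.ext_linner fun w => ?_
  rw [← M.act_act_inv h w, M.linner_act, M.linner_left, M.linner_left, M.linner_act, map_mul]

theorem exists_left_eq_right (w : A) (hw : ∀ a, w * a = a * w) :
    ∃ v : A, ∀ x, M.left v x = M.right (op w) x := by
  obtain ⟨s, hs⟩ := M.exists_unit_linner
  have key : ∀ c ∈ Submodule.span ℂ {a | ∃ x y, M.linner x y = a},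
      ∃ v : A, ∀ x, M.left v x = M.right (op w) (M.left c x) := by
    intro c hc
    induction hc using Submodule.span_induction with
    | mem c hc =>
      obtain ⟨x, y, rfl⟩ := hc
      refine ⟨M.linner (M.right (op w) x) y, fun m => ?_⟩
      rw [M.left_linner, M.left_linner, ← Module.End.mul_apply, ← Module.End.mul_apply,
        ← map_mul, ← map_mul, ← op_mul, ← op_mul, hw]
    | zero => exact ⟨0, fun x => by simp⟩
    | add c d _ _ hc hd =>
      obtain ⟨v, hv⟩ := hc
      obtain ⟨v', hv'⟩ := hd
      exact ⟨v + v', fun x => by simp [hv, hv']⟩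
    | smul z c _ hc =>
      obtain ⟨v, hv⟩ := hc
      exact ⟨z • v, fun x => by simp [hv]⟩
  obtain ⟨v, hv⟩ := key s hs
  refine ⟨v * ((s⁻¹ : Aˣ) : A), fun x => ?_⟩
  rw [map_mul, Module.End.mul_apply, hv, ← Module.End.mul_apply (M.left _), ← map_mul,
    Units.mul_inv, map_one, Module.End.one_apply]

theorem exists_right_eq_left (v : A) (hv : ∀ a, v * a = a * v) :
    ∃ w : A, ∀ x, M.left v x = M.right (op w) x := by
  obtain ⟨s, hs⟩ := M.exists_unit_rinner
  have key : ∀ c ∈ Submodule.span ℂ {a | ∃ x y, M.rinner x y = a},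
      ∃ w : A, ∀ x, M.left v (M.right (op c) x) = M.right (op w) x := by
    intro c hc
    induction hc using Submodule.span_induction with
    | mem c hc =>
      obtain ⟨x, y, rfl⟩ := hc
      refine ⟨M.rinner x (M.left v y), fun m => ?_⟩
      rw [← M.left_linner, ← M.left_linner, ← Module.End.mul_apply, ← map_mul, hv, map_mul,
        Module.End.mul_apply, M.left_linner]
    | zero => exact ⟨0, fun x => by simp⟩
    | add c d _ _ hc hd =>
      obtain ⟨v, hv⟩ := hc
      obtain ⟨v', hv'⟩ := hd
      exact ⟨v + v', fun x => by simp [hv, hv']⟩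
    | smul z c _ hc =>
      obtain ⟨v, hv⟩ := hc
      exact ⟨z • v, fun x => by simp [hv]⟩
  obtain ⟨w, hw⟩ := key s hs
  refine ⟨((s⁻¹ : Aˣ) : A) * w, fun x => ?_⟩
  rw [op_mul, map_mul, Module.End.mul_apply, ← hw, ← Module.End.mul_apply (M.right _), ← map_mul,
    ← op_mul, Units.inv_mul, op_one, map_one, Module.End.one_apply]

theorem central_of_right {v w : A} (h : ∀ x, M.left v x = M.right (op w) x) (a : A) :
    v * a = a * v :=
  M.left_faithful fun x => by
    rw [map_mul, map_mul, Module.End.mul_apply, Module.End.mul_apply, h, h, M.left_right]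

theorem central_of_left {v w : A} (h : ∀ x, M.left v x = M.right (op w) x) (a : A) :
    w * a = a * w :=
  M.right_faithful fun x => by
    rw [op_mul, op_mul, map_mul, map_mul, Module.End.mul_apply, Module.End.mul_apply, ← h, ← h,
      M.left_right]

theorem star_left_right {v w : A} (h : ∀ x, M.left v x = M.right (op w) x) (x : M) :
    M.left (star v) x = M.right (op (star w)) x := by
  refine M.ext_linner fun y => ?_
  rw [M.linner_right, star_star, ← h, ← M.star_linner (M.left v y) x, M.linner_left, M.linner_left,
    star_mul, M.star_linner]
  have := congrArg star (M.central_of_right h (star (M.linner x y)))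
  simpa using this.symm

theorem left_mul_right {v w v' w' : A} (h : ∀ x, M.left v x = M.right (op w) x)
    (h' : ∀ x, M.left v' x = M.right (op w') x) (x : M) :
    M.left (v * v') x = M.right (op (w * w')) x := by
  rw [map_mul, Module.End.mul_apply, h', M.left_right, h, op_mul, map_mul, Module.End.mul_apply]

theorem mem_of_right {v : A} (w : β.centralUnitary)
    (h : ∀ x, M.left v x = M.right (op ((w : unitary A) : A)) x) :
    ∃ hv : v ∈ unitary A, (⟨v, hv⟩ : unitary A) ∈ β.centralUnitary := by
  have h1 : ∀ x, M.left 1 x = M.right (op 1) x := fun x => by simp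
  refine ⟨Unitary.mem_iff.mpr ⟨?_, ?_⟩, M.central_of_right h, fun g => ?_⟩
  · refine M.left_faithful fun x => ?_
    rw [M.left_mul_right (M.star_left_right h) h, h1, Unitary.coe_star_mul_self]
  · refine M.left_faithful fun x => ?_
    rw [M.left_mul_right h (M.star_left_right h), h1, Unitary.mul_star_self_of_mem (SetLike.coe_mem _)]
  · refine M.left_faithful fun x => ?_
    rw [← M.act_act_inv g x, ← M.act_left, h, M.act_right, w.2.2, h]

theorem mem_of_left {w : A} (v : β.centralUnitary)
    (h : ∀ x, M.left ((v : unitary A) : A) x = M.right (op w) x) :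
    ∃ hw : w ∈ unitary A, (⟨w, hw⟩ : unitary A) ∈ β.centralUnitary := by
  have h1 : ∀ x, M.left 1 x = M.right (op 1) x := fun x => by simp
  refine ⟨Unitary.mem_iff.mpr ⟨?_, ?_⟩, M.central_of_left h, fun g => ?_⟩
  · refine M.right_faithful fun x => ?_
    rw [← M.left_mul_right (M.star_left_right h) h, ← h1, Unitary.coe_star_mul_self]
  · refine M.right_faithful fun x => ?_
    rw [← M.left_mul_right h (M.star_left_right h), ← h1, Unitary.mul_star_self_of_mem (SetLike.coe_mem _)]
  · refine M.right_faithful fun x => ?_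
    rw [← M.act_act_inv g x, ← M.act_right, ← h, M.act_left, v.2.2, h]

theorem existsUnique_frohlich (w : β.centralUnitary) : ∃! v : β.centralUnitary,
    ∀ x, M.left ((v : unitary A) : A) x = M.right (op ((w : unitary A) : A)) x := by
  obtain ⟨v, hv⟩ := M.exists_left_eq_right _ w.2.1
  obtain ⟨h1, h2⟩ := M.mem_of_right w hv
  refine ⟨⟨⟨v, h1⟩, h2⟩, hv, fun v' hv' => ?_⟩
  apply Subtype.ext; apply Subtype.ext
  exact M.left_faithful fun x => by rw [hv' x, hv x]

theorem existsUnique_frohlich_symm (v : β.centralUnitary) : ∃! w : β.centralUnitary,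
    ∀ x, M.left ((v : unitary A) : A) x = M.right (op ((w : unitary A) : A)) x := by
  obtain ⟨w, hw⟩ := M.exists_right_eq_left _ v.2.1
  obtain ⟨h1, h2⟩ := M.mem_of_left v hw
  refine ⟨⟨⟨w, h1⟩, h2⟩, hw, fun w' hw' => ?_⟩
  apply Subtype.ext; apply Subtype.ext
  exact M.right_faithful fun x => by rw [← hw' x, ← hw x]

/-- The automorphism `Δ_M` of `U(Z(A)^H)` determined by `Δ_M(w) x = x w` for all `x ∈ M`. -/
noncomputable def frohlich : MulAut β.centralUnitary where
  toFun w := (M.existsUnique_frohlich w).choose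
  invFun v := (M.existsUnique_frohlich_symm v).choose
  left_inv w := ((M.existsUnique_frohlich_symm _).choose_spec.2 w
    (M.existsUnique_frohlich w).choose_spec.1).symm
  right_inv v := ((M.existsUnique_frohlich _).choose_spec.2 v
    (M.existsUnique_frohlich_symm v).choose_spec.1).symm
  map_mul' w w' := ((M.existsUnique_frohlich _).choose_spec.2 _
    (M.left_mul_right (M.existsUnique_frohlich w).choose_spec.1
      (M.existsUnique_frohlich w').choose_spec.1)).symm

theorem left_frohlich (w : β.centralUnitary) (x : M) :
    M.left ((M.frohlich w : unitary A) : A) x = M.right (op ((w : unitary A) : A)) x :=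
  (M.existsUnique_frohlich w).choose_spec.1 x

theorem frohlich_unique {v w : β.centralUnitary}
    (h : ∀ x, M.left ((v : unitary A) : A) x = M.right (op ((w : unitary A) : A)) x) :
    M.frohlich w = v :=
  ((M.existsUnique_frohlich w).choose_spec.2 v h).symm

theorem frohlich_congr {M N : MoritaSelfEquivalence β} (e : Iso M N) : M.frohlich = N.frohlich := by
  ext1 w
  refine M.frohlich_unique fun x => ?_
  apply e.toEquiv.injective
  rw [e.map_left, e.map_right, N.left_frohlich]

theorem IsInternalTensor.frohlich_eq {M N P : MoritaSelfEquivalence β} {t : M →ₗ[ℂ] N →ₗ[ℂ] P}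
    (ht : IsInternalTensor M N P t) : P.frohlich = M.frohlich * N.frohlich := by
  ext1 w
  apply Subtype.ext; apply Subtype.ext
  set v : A := ((P.frohlich w : unitary A) : A) with hv
  set v' : A := (((M.frohlich * N.frohlich) w : unitary A) : A) with hv'
  have h1 : ∀ x y, P.left v (t x y) = P.left v' (t x y) := by
    intro x y
    rw [hv, P.left_frohlich, ht.right_apply, ← N.left_frohlich, ← ht.balanced, ← M.left_frohlich,
      ht.left_apply, hv', MulAut.mul_apply]
  have h2 : ∀ p ∈ Submodule.span ℂ {p | ∃ x y, t x y = p}, P.left (v - v') p = 0 := by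
    intro p hp
    induction hp using Submodule.span_induction with
    | mem p hp => obtain ⟨x, y, rfl⟩ := hp; simp [h1]
    | zero => simp
    | add p q _ _ hp hq => rw [map_add, hp, hq, add_zero]
    | smul z p _ hp => rw [map_smul, hp, smul_zero]
  refine sub_eq_zero.mp (P.left_faithful fun p => ?_)
  rw [map_zero, LinearMap.zero_apply]
  have hcont : Continuous fun p => P.left (v - v') p := by
    refine AddMonoidHomClass.continuous_of_bound (P.left (v - v')) ‖v - v'‖ fun p => ?_
    have h3 : ‖P.left (v - v') p‖ ^ 2 ≤ (‖v - v'‖ * ‖p‖) ^ 2 := by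
      rw [← P.norm_linner, P.linner_left, ← P.star_linner (P.left _ p) p, P.linner_left, star_mul,
        P.star_linner, ← mul_assoc, mul_pow, ← P.norm_linner]
      refine (norm_mul_le _ _).trans ?_
      rw [norm_star]
      calc _ ≤ ‖v - v'‖ * ‖P.linner p p‖ * ‖v - v'‖ := by gcongr; exact norm_mul_le _ _
        _ = _ := by ring
    exact le_of_sq_le_sq h3 (by positivity)
  exact congrFun (Continuous.ext_on ht.dense_span hcont continuous_const h2) p

end MoritaSelfEquivalence

/-- The set `Pic_H(A)` of equivalence classes of Morita self-equivalences over `(A, H, β)`. -/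
def Pic (β : CStarSystem H A) : Type _ :=
  Quotient (MoritaSelfEquivalence.setoid β)

/-- The class `[M]` in `Pic_H(A)`. -/
def MoritaSelfEquivalence.cls {β : CStarSystem H A} (M : MoritaSelfEquivalence β) : Pic β :=
  Quotient.mk _ M

namespace Pic

variable {β : CStarSystem H A}

/-- `c` is the product of `a` and `b` in `Pic_H(A)`: it is the class of the internal tensor product
of representatives of `a` and `b`. -/
def IsProduct (a b c : Pic β) : Prop :=
  ∃ (M N P : MoritaSelfEquivalence β) (t : M →ₗ[ℂ] N →ₗ[ℂ] P),
    M.cls = a ∧ N.cls = b ∧ P.cls = c ∧ MoritaSelfEquivalence.IsInternalTensor M N P t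

/-- The automorphism `Δ_M` for any `M` in the class. -/
noncomputable def frohlich (a : Pic β) : MulAut β.centralUnitary :=
  Quotient.lift (s := MoritaSelfEquivalence.setoid β) (fun M => M.frohlich)
    (fun _ _ h => h.elim MoritaSelfEquivalence.frohlich_congr) a

theorem IsProduct.frohlich_eq {a b c : Pic β} (h : IsProduct a b c) :
    c.frohlich = a.frohlich * b.frohlich := by
  obtain ⟨M, N, P, t, rfl, rfl, rfl, ht⟩ := h
  exact ht.frohlich_eq

end Pic

/-- A group homomorphism `Γ → Pic_H(A)`. -/
structure PicHom (Γ : Type*) [Group Γ] (β : CStarSystem H A) where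
  toFun : Γ → Pic β
  map_mul : ∀ χ χ', Pic.IsProduct (toFun χ) (toFun χ') (toFun (χ * χ'))

/-- The group homomorphism `Δ : Γ → Aut(U(Z(A)^H))` induced by a group homomorphism
`Γ → Pic_H(A)`. -/
noncomputable def PicHom.frohlich {Γ : Type*} [Group Γ] {β : CStarSystem H A} (p : PicHom Γ β) :
    Γ →* MulAut β.centralUnitary :=
  MonoidHom.mk' (fun χ => (p.toFun χ).frohlich) fun χ χ' => (p.map_mul χ χ').frohlich_eq

end Morita

/-! ## Group cohomology in degree two -/

section Cohomology

variable {Γ U : Type*} [Group Γ] [CommGroup U]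

/-- `Z²_Δ(Γ, U)`: the maps `ω` with
`ω(χχ', χ'') ω(χ, χ') = Δ_χ(ω(χ', χ'')) ω(χ, χ'χ'')`. -/
def Z2 (Δ : Γ →* MulAut U) : Set (Γ × Γ → U) :=
  letI : MulDistribMulAction Γ U := MulDistribMulAction.compHom U Δ
  {ω | groupCohomology.IsMulCocycle₂ ω}

/-- `B²_Δ(Γ, U)`: the maps `ω` of the form
`ω(χ, χ') = Δ_χ(ϖ(χ')) ϖ(χχ')⁻¹ ϖ(χ)` for some `ϖ : Γ → U`. -/
def B2 (Δ : Γ →* MulAut U) : Set (Γ × Γ → U) :=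
  letI : MulDistribMulAction Γ U := MulDistribMulAction.compHom U Δ
  {ω | groupCohomology.IsMulCoboundary₂ ω}

theorem mem_Z2 {Δ : Γ →* MulAut U} {ω : Γ × Γ → U} : ω ∈ Z2 Δ ↔ ∀ χ χ' χ'',
    ω (χ * χ', χ'') * ω (χ, χ') = Δ χ (ω (χ', χ'')) * ω (χ, χ' * χ'') :=
  Iff.rfl

theorem mem_B2 {Δ : Γ →* MulAut U} {ω : Γ × Γ → U} : ω ∈ B2 Δ ↔ ∃ ϖ : Γ → U, ∀ χ χ',
    Δ χ (ϖ χ') / ϖ (χ * χ') * ϖ χ = ω (χ, χ') :=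
  Iff.rfl

end Cohomology

/-! ## Central extensions and `Ĝ`-structures -/

/-- A central extension `1 → Z → Ĝ → G → 1` of topological groups (for compact Hausdorff groups,
`ι` is then automatically an embedding and `q` a quotient map). -/
structure CentralExtension (Z Gh G : Type*) [CommGroup Z] [TopologicalSpace Z] [Group Gh]
    [TopologicalSpace Gh] [Group G] [TopologicalSpace G] where
  ι : Z →ₜ* Gh
  q : Gh →ₜ* G
  ι_injective : Function.Injective ι
  q_surjective : Function.Surjective q
  exact : ∀ g, q g = 1 ↔ ∃ z, ι z = g
  central : ∀ z g, ι z * g = g * ι z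

section Structures

variable {Z Gh G : Type*} [CommGroup Z] [TopologicalSpace Z] [Group Gh] [TopologicalSpace Gh]
  [Group G] [TopologicalSpace G] {A : Type u} [CStarAlgebra A]

/-- A `Ĝ`-structure for `(A, G, α)`: a free C*-dynamical system `(Â, Ĝ, α̂)` whose fixed point
algebra under `Z` is `A` (included by `incl`), the action induced on it being `α`. The fixed point
algebra under `Ĝ` is then that of `(A, G, α)`. -/
structure GHatStructure (E : CentralExtension Z Gh G) (α : CStarSystem G A) where
  carrier : Type u
  [cstarAlgebra : CStarAlgebra carrier]
  system : CStarSystem Gh carrier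
  free : system.IsFree
  incl : A →⋆ₐ[ℂ] carrier
  incl_injective : Function.Injective incl
  mem_range_incl : ∀ x, x ∈ Set.range incl ↔ ∀ z, system.act (E.ι z) x = x
  act_incl : ∀ g a, system.act g (incl a) = incl (α.act (E.q g) a)

namespace GHatStructure

attribute [instance] cstarAlgebra

variable {E : CentralExtension Z Gh G} {α : CStarSystem G A}

instance : CoeSort (GHatStructure E α) (Type u) := ⟨carrier⟩

/-- An equivalence of `Ĝ`-structures: a `Ĝ`-equivariant *-isomorphism that is the identity
on `A`. -/
structure Equivalence (S T : GHatStructure E α) where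
  toEquiv : S ≃⋆ₐ[ℂ] T
  map_act : ∀ g x, toEquiv (S.system.act g x) = T.system.act g (toEquiv x)
  map_incl : ∀ a, toEquiv (S.incl a) = T.incl a

instance setoid (E : CentralExtension Z Gh G) (α : CStarSystem G A) :
    Setoid (GHatStructure E α) where
  r S T := Nonempty (Equivalence S T)
  iseqv :=
    { refl := fun S => ⟨⟨StarAlgEquiv.refl ℂ S, fun _ _ => rfl, fun _ => rfl⟩⟩
      symm := fun ⟨e⟩ => ⟨⟨e.toEquiv.symm,
        fun g x => by
          apply EquivLike.injective e.toEquiv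
          rw [e.map_act, StarAlgEquiv.apply_symm_apply, StarAlgEquiv.apply_symm_apply],
        fun a => by
          apply EquivLike.injective e.toEquiv
          rw [e.map_incl, StarAlgEquiv.apply_symm_apply]⟩⟩
      trans := fun ⟨e⟩ ⟨f⟩ => ⟨⟨e.toEquiv.trans f.toEquiv,
        fun g x => by simp [StarAlgEquiv.trans_apply, e.map_act, f.map_act],
        fun a => by simp [StarAlgEquiv.trans_apply, e.map_incl, f.map_incl]⟩⟩ }

variable (S : GHatStructure E α)

/-- The `Z`-isotypic component `Â(χ)`. -/
def isotypic (χ : PontryaginDual Z) : Submodule ℂ S where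
  carrier := {x | ∀ z, S.system.act (E.ι z) x = (χ z : ℂ) • x}
  add_mem' hx hy z := by rw [map_add, hx z, hy z, smul_add]
  zero_mem' z := by simp
  smul_mem' c x hx z := by rw [map_smul, hx z, smul_comm]

variable {S}

theorem mul_mem_isotypic {χ χ' : PontryaginDual Z} {x y : S} (hx : x ∈ S.isotypic χ)
    (hy : y ∈ S.isotypic χ') : x * y ∈ S.isotypic (χ * χ') := fun z => by
  have h : (χ * χ') z = χ z * χ' z := rfl
  rw [map_mul, hx z, hy z, smul_mul_smul_comm, h, Circle.coe_mul]

theorem star_mem_isotypic {χ : PontryaginDual Z} {x : S} (hx : x ∈ S.isotypic χ) :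
    star x ∈ S.isotypic χ⁻¹ := fun z => by
  have h : χ⁻¹ z = (χ z)⁻¹ := rfl
  rw [map_star, hx z, star_smul, h, Circle.coe_inv_eq_conj]
  rfl

theorem mem_range_incl_of_isotypic {x : S} (hx : x ∈ S.isotypic 1) : x ∈ Set.range S.incl :=
  (S.mem_range_incl x).mpr fun z => by
    have h : (1 : PontryaginDual Z) z = 1 := rfl
    rw [hx z, h, Circle.coe_one, one_smul]

theorem incl_mem_isotypic (a : A) : S.incl a ∈ S.isotypic 1 := fun z => by
  have h : (1 : PontryaginDual Z) z = 1 := rfl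
  rw [(S.mem_range_incl _).mp ⟨a, rfl⟩ z, h, Circle.coe_one, one_smul]

theorem incl_mul_mem {χ : PontryaginDual Z} {x : S} (a : A) (hx : x ∈ S.isotypic χ) :
    S.incl a * x ∈ S.isotypic χ := by
  simpa using mul_mem_isotypic (incl_mem_isotypic a) hx

theorem mul_incl_mem {χ : PontryaginDual Z} {x : S} (a : A) (hx : x ∈ S.isotypic χ) :
    x * S.incl a ∈ S.isotypic χ := by
  simpa using mul_mem_isotypic hx (incl_mem_isotypic a)

theorem exists_incl_mul_star {χ : PontryaginDual Z} {x y : S} (hx : x ∈ S.isotypic χ)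
    (hy : y ∈ S.isotypic χ) : ∃ a, S.incl a = x * star y :=
  mem_range_incl_of_isotypic (by simpa using mul_mem_isotypic hx (star_mem_isotypic hy))

theorem exists_incl_star_mul {χ : PontryaginDual Z} {x y : S} (hx : x ∈ S.isotypic χ)
    (hy : y ∈ S.isotypic χ) : ∃ a, S.incl a = star x * y :=
  mem_range_incl_of_isotypic (by simpa using mul_mem_isotypic (star_mem_isotypic hx) hy)

theorem act_mem_isotypic {χ : PontryaginDual Z} {x : S} (g : Gh) (hx : x ∈ S.isotypic χ) :
    S.system.act g x ∈ S.isotypic χ := fun z => by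
  rw [← StarAlgEquiv.mul_apply, ← map_mul, E.central, map_mul, StarAlgEquiv.mul_apply,
    hx z, map_smul]

theorem norm_incl (a : A) : ‖S.incl a‖ = ‖a‖ :=
  NonUnitalStarAlgHom.norm_map S.incl S.incl_injective a

theorem exists_star_mul_self {a : A} {x : S} (h : S.incl a = star x * x) :
    ∃ b, a = star b * b := by
  let _ := CStarAlgebra.spectralOrder A
  have := CStarAlgebra.spectralOrderedRing A
  let _ := CStarAlgebra.spectralOrder S.carrier
  have := CStarAlgebra.spectralOrderedRing S.carrier
  have h0 : 0 ≤ S.incl a := h ▸ star_mul_self_nonneg x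
  have hsa : IsSelfAdjoint a := by
    apply S.incl_injective
    rw [map_star, h0.isSelfAdjoint.star_eq]
  have ha : 0 ≤ a := by
    rw [StarOrderedRing.nonneg_iff_spectrum_nonneg (R := ℝ) _ hsa,
      ← hsa.map_spectrum_real S.incl S.incl_injective]
    exact fun r hr => spectrum_nonneg_of_nonneg h0 hr
  exact CStarAlgebra.nonneg_iff_eq_star_mul_self.mp ha

theorem isClosed_isotypic (χ : PontryaginDual Z) : IsClosed (S.isotypic χ : Set S) := by
  have : (S.isotypic χ : Set S) = ⋂ z, {x | S.system.act (E.ι z) x = (χ z : ℂ) • x} := by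
    ext x; simp [isotypic]
  rw [this]
  refine isClosed_iInter fun z => isClosed_eq ?_ (continuous_const_smul _)
  exact (StarAlgEquiv.isometry _).continuous


/-- The left multiplication of `A` on `Â(χ)`. -/
def isotypicLeft (S : GHatStructure E α) (χ : PontryaginDual Z) :
    A →ₐ[ℂ] Module.End ℂ (S.isotypic χ) where
  toFun a :=
    { toFun := fun x => ⟨S.incl a * x, incl_mul_mem a x.2⟩
      map_add' := fun x y => Subtype.ext (mul_add _ _ _)
      map_smul' := fun c x => Subtype.ext (mul_smul_comm _ _ _) }
  map_one' := by ext x; simp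
  map_mul' a b := by ext x; simp [mul_assoc]
  map_zero' := by ext x; simp
  map_add' a b := by ext x; simp [add_mul]
  commutes' c := by ext x; simp [Algebra.algebraMap_eq_smul_one]

/-- The right multiplication of `A` on `Â(χ)`. -/
def isotypicRight (S : GHatStructure E α) (χ : PontryaginDual Z) :
    Aᵐᵒᵖ →ₐ[ℂ] Module.End ℂ (S.isotypic χ) where
  toFun a :=
    { toFun := fun x => ⟨x * S.incl a.unop, mul_incl_mem a.unop x.2⟩
      map_add' := fun x y => Subtype.ext (add_mul _ _ _)
      map_smul' := fun c x => Subtype.ext (smul_mul_assoc _ _ _) }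
  map_one' := by ext x; simp
  map_mul' a b := by ext x; simp [mul_assoc]
  map_zero' := by ext x; simp
  map_add' a b := by ext x; simp [mul_add]
  commutes' c := by ext x; simp [Algebra.algebraMap_eq_smul_one]

/-- The left inner product `x y*` on `Â(χ)`. -/
noncomputable def isotypicLinner {S : GHatStructure E α} {χ : PontryaginDual Z}
    (x y : S.isotypic χ) : A :=
  (exists_incl_mul_star x.2 y.2).choose

theorem incl_isotypicLinner {S : GHatStructure E α} {χ : PontryaginDual Z}
    (x y : S.isotypic χ) : S.incl (isotypicLinner x y) = x * star (y : S) :=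
  (exists_incl_mul_star x.2 y.2).choose_spec

/-- The right inner product `x* y` on `Â(χ)`. -/
noncomputable def isotypicRinner {S : GHatStructure E α} {χ : PontryaginDual Z}
    (x y : S.isotypic χ) : A :=
  (exists_incl_star_mul x.2 y.2).choose

theorem incl_isotypicRinner {S : GHatStructure E α} {χ : PontryaginDual Z}
    (x y : S.isotypic χ) : S.incl (isotypicRinner x y) = star (x : S) * y :=
  (exists_incl_star_mul x.2 y.2).choose_spec

/-- The action of `Ĝ` on `Â(χ)`. -/
def isotypicAct (S : GHatStructure E α) (χ : PontryaginDual Z) :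
    Gh →* (S.isotypic χ ≃ₗ[ℂ] S.isotypic χ) where
  toFun g :=
    { toFun := fun x => ⟨S.system.act g x, act_mem_isotypic g x.2⟩
      map_add' := fun x y => Subtype.ext (map_add _ _ _)
      map_smul' := fun c x => Subtype.ext (map_smul _ _ _)
      invFun := fun x => ⟨S.system.act g⁻¹ x, act_mem_isotypic g⁻¹ x.2⟩
      left_inv := fun x => Subtype.ext <| by
        simp [← StarAlgEquiv.mul_apply]
      right_inv := fun x => Subtype.ext <| by
        simp [← StarAlgEquiv.mul_apply] }
  map_one' := by ext x; simp
  map_mul' g h := by ext x; simp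

/-- The multiplication `Â(χ) × Â(χ') → Â(χχ')`. -/
noncomputable def isotypicMul (S : GHatStructure E α) (χ χ' : PontryaginDual Z) :
    S.isotypic χ →ₗ[ℂ] S.isotypic χ' →ₗ[ℂ] S.isotypic (χ * χ') :=
  LinearMap.mk₂ ℂ (fun x y => ⟨x * y, mul_mem_isotypic x.2 y.2⟩)
    (fun _ _ _ => Subtype.ext (add_mul _ _ _)) (fun _ _ _ => Subtype.ext (smul_mul_assoc _ _ _))
    (fun _ _ _ => Subtype.ext (mul_add _ _ _)) (fun _ _ _ => Subtype.ext (mul_smul_comm _ _ _))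

section Fullness

variable [IsTopologicalGroup Z] [CompactSpace Z] [CompactSpace Gh] [T2Space Gh]

open MeasureTheory in
theorem exists_near_one (S : GHatStructure E α) (χ : PontryaginDual Z) {ε : ℝ} (hε : 0 < ε) :
    ∃ c ∈ Submodule.span ℂ {a : A | ∃ x ∈ S.isotypic χ, ∃ y ∈ S.isotypic χ,
      S.incl a = star x * y}, ‖c - 1‖ ≤ ε := by
  let _ : MeasurableSpace Z := borel Z
  have : BorelSpace Z := ⟨rfl⟩
  let μ : Measure Z := Measure.haarMeasure ⊤
  have : IsProbabilityMeasure μ := ⟨Measure.haarMeasure_self⟩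
  have hint : ∀ f : Z → S, Continuous f → Integrable f μ := fun f hf =>
    hf.integrable_of_hasCompactSupport (HasCompactSupport.of_compactSpace f)
  have hθ : ∀ x : S, Continuous fun z => S.system.act (E.ι z) x := fun x =>
    (S.system.continuous_act x).comp E.ι.continuous_toFun
  have hψ : ∀ ψ : PontryaginDual Z, Continuous fun z => ((ψ z : Circle) : ℂ) := fun ψ =>
    continuous_induced_dom.comp (map_continuous ψ)
  have hsm : ∀ (ψ : PontryaginDual Z) (f : Z → S), Continuous f →
      Integrable (fun z => ((ψ z : Circle) : ℂ) • f z) μ := fun ψ f hf => hint _ ((hψ ψ).smul hf)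
  -- the projection onto an isotypic component
  let P : PontryaginDual Z → S → S := fun ψ x =>
    ∫ z, ((ψ⁻¹ z : Circle) : ℂ) • S.system.act (E.ι z) x ∂μ
  have hP : ∀ ψ x, P ψ x ∈ S.isotypic ψ := by
    intro ψ x w
    let L : S →L[ℂ] S := ⟨((S.system.act (E.ι w) : S ≃⋆ₐ[ℂ] S) : S →⋆ₐ[ℂ] S).toLinearMap,
      (StarAlgEquiv.isometry (S.system.act (E.ι w))).continuous⟩
    have hL : ∀ y, S.system.act (E.ι w) y = L y := fun y => rfl
    have h1 := L.integral_comp_comm (hsm ψ⁻¹ _ (hθ x))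
    have h2 := integral_mul_left_eq_self (μ := μ)
      (fun z => ((ψ⁻¹ (w⁻¹ * z) : Circle) : ℂ) • S.system.act (E.ι z) x) w
    calc S.system.act (E.ι w) (P ψ x)
        = ∫ z, L (((ψ⁻¹ z : Circle) : ℂ) • S.system.act (E.ι z) x) ∂μ := h1.symm
      _ = ∫ z, ((ψ⁻¹ (w⁻¹ * (w * z)) : Circle) : ℂ) • S.system.act (E.ι (w * z)) x ∂μ := by
          refine integral_congr_ae (Filter.Eventually.of_forall fun z => ?_)
          simp only [inv_mul_cancel_left]
          rw [map_smul, ← hL, map_mul E.ι, map_mul, StarAlgEquiv.mul_apply]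
      _ = ∫ z, (((ψ w : Circle) : ℂ) * ((ψ⁻¹ z : Circle) : ℂ)) • S.system.act (E.ι z) x ∂μ := by
          rw [h2]
          refine integral_congr_ae (Filter.Eventually.of_forall fun z => ?_)
          have h3 : ψ⁻¹ w⁻¹ = ψ w := by
            change (ψ w⁻¹)⁻¹ = ψ w
            rw [map_inv, inv_inv]
          simp only [map_mul, h3, Circle.coe_mul]
      _ = _ := by simp_rw [mul_smul]; rw [integral_smul]
  -- Fourier coefficient
  let F : (Z → S) → S := fun f => ∫ z, ((χ⁻¹ z : Circle) : ℂ) • f z ∂μ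
  let T : (Z → S) → S := fun f => P 1 (F f)
  have hFadd : ∀ f f' : Z → S, Continuous f → Continuous f' → F (f + f') = F f + F f' := by
    intro f f' hf hf'
    refine Eq.trans ?_ (integral_add (hsm χ⁻¹ _ hf) (hsm χ⁻¹ _ hf'))
    simp only [F, Pi.add_apply, smul_add]
  have hPadd : ∀ ψ x y, P ψ (x + y) = P ψ x + P ψ y := by
    intro ψ x y
    refine Eq.trans ?_ (integral_add (hsm ψ⁻¹ _ (hθ x)) (hsm ψ⁻¹ _ (hθ y)))
    simp only [P, map_add, smul_add]
  have hmul : ∀ x y, T (fun z => x * S.system.act (E.ι z) y) = star (P χ (star x)) * P χ y := by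
    intro x y
    have h1 : F (fun z => x * S.system.act (E.ι z) y) = x * P χ y := by
      simp only [F, P, ← mul_smul_comm]
      exact integral_const_mul_of_integrable (hsm χ⁻¹ _ (hθ y))
    have h2 : ∀ z, S.system.act (E.ι z) (x * P χ y)
        = star (((χ⁻¹ z : Circle) : ℂ) • S.system.act (E.ι z) (star x)) * P χ y := by
      intro z
      have h3 : χ⁻¹ z = (χ z)⁻¹ := rfl
      rw [map_mul, hP χ y z, star_smul, map_star, star_star, h3, Circle.coe_inv_eq_conj,
        mul_smul_comm, smul_mul_assoc]
      simp
    have h4 : ∀ z : Z, (1 : PontryaginDual Z)⁻¹ z = 1 := fun z => by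
      change (1 : Circle)⁻¹ = 1
      simp
    have h5 : star (P χ (star x))
        = ∫ z, star (((χ⁻¹ z : Circle) : ℂ) • S.system.act (E.ι z) (star x)) ∂μ :=
      ((starL' ℝ : S ≃L[ℝ] S) : S →L[ℝ] S).integral_comp_comm
        (hsm χ⁻¹ _ (hθ (star x))) |>.symm
    simp only [T]
    rw [h1, h5]
    refine (integral_congr_ae (g := fun z => star (((χ⁻¹ z : Circle) : ℂ) •
      S.system.act (E.ι z) (star x)) * P χ y) (Filter.Eventually.of_forall fun z => ?_)).trans ?_
    · refine Eq.trans ?_ (h2 z)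
      exact (congrArg (fun w : Circle => (w : ℂ) • S.system.act (E.ι z) (x * P χ y)) (h4 z)).trans
        (one_smul ℂ _)
    exact integral_mul_const_of_integrable
      (hint _ (((hψ χ⁻¹).smul (hθ (star x))).star))
  have hTmem : ∀ t : S ⊗[ℂ] S, ∃ c ∈ Submodule.span ℂ {a : A | ∃ x ∈ S.isotypic χ,
      ∃ y ∈ S.isotypic χ, S.incl a = star x * y},
      S.incl c = T (fun z => S.system.ellwoodMap t (E.ι z)) := by
    intro t
    have hc : ∀ t, Continuous fun z => S.system.ellwoodMap t (E.ι z) := fun t =>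
      (S.system.ellwoodMap t).continuous.comp E.ι.continuous_toFun
    induction t using TensorProduct.induction_on with
    | zero => exact ⟨0, Submodule.zero_mem _, by simp [T, F, P]⟩
    | tmul x y =>
      obtain ⟨a, ha⟩ := exists_incl_star_mul (hP χ (star x)) (hP χ y)
      exact ⟨a, Submodule.subset_span ⟨_, hP _ _, _, hP _ _, ha⟩, ha.trans (hmul x y).symm⟩
    | add t t' h h' =>
      obtain ⟨c, hc1, hc2⟩ := h
      obtain ⟨c', hc1', hc2'⟩ := h'
      refine ⟨c + c', Submodule.add_mem _ hc1 hc1', ?_⟩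
      rw [map_add, hc2, hc2']
      simp only [T]
      rw [← hPadd, ← hFadd _ _ (hc t) (hc t')]
      simp only [map_add]
      rfl
  -- approximate `χ` on `Z`
  have hemb : Topology.IsClosedEmbedding E.ι :=
    E.ι.continuous_toFun.isClosedEmbedding E.ι_injective
  obtain ⟨g, hg⟩ := ContinuousMap.exists_extension' hemb (⟨fun z => ((χ z : Circle) : ℂ), hψ χ⟩ : C(Z, ℂ))
  let h : C(Gh, S) := ⟨fun x => g x • (1 : S), g.continuous.smul continuous_const⟩
  obtain ⟨_, ht, ⟨t, rfl⟩⟩ := Metric.dense_iff.mp S.free h ε hε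
  obtain ⟨c, hc, hcT⟩ := hTmem t
  refine ⟨c, hc, ?_⟩
  rw [← norm_incl (S := S), map_sub, map_one, hcT]
  have hpt : ∀ z, ‖S.system.ellwoodMap t (E.ι z) - ((χ z : Circle) : ℂ) • (1 : S)‖ ≤ ε := by
    intro z
    have h1 : g (E.ι z) = ((χ z : Circle) : ℂ) := congrFun hg z
    rw [← h1, ← dist_eq_norm]
    exact (ContinuousMap.dist_apply_le_dist (E.ι z)).trans (Metric.mem_ball.mp ht).le
  have hF : ‖F (fun z => S.system.ellwoodMap t (E.ι z)) - 1‖ ≤ ε := by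
    have h1 : (1 : S) = ∫ _ : Z, (1 : S) ∂μ := by simp
    have hcont : Continuous fun z => S.system.ellwoodMap t (E.ι z) :=
      (S.system.ellwoodMap t).continuous.comp E.ι.continuous_toFun
    simp only [F]
    conv_lhs => rw [h1]
    rw [← integral_sub (hsm χ⁻¹ _ hcont) (hint _ continuous_const)]
    have h2 := norm_integral_le_of_norm_le_const (μ := μ) (C := ε)
      (f := fun z => ((χ⁻¹ z : Circle) : ℂ) • S.system.ellwoodMap t (E.ι z) - (1 : S))
      (Filter.Eventually.of_forall fun z => by
        have h3 : ((χ⁻¹ z : Circle) : ℂ) * ((χ z : Circle) : ℂ) = 1 := by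
          rw [← Circle.coe_mul]
          have : χ⁻¹ z = (χ z)⁻¹ := rfl
          rw [this, inv_mul_cancel, Circle.coe_one]
        have h4 : ((χ⁻¹ z : Circle) : ℂ) • S.system.ellwoodMap t (E.ι z) - (1 : S)
            = ((χ⁻¹ z : Circle) : ℂ) •
              (S.system.ellwoodMap t (E.ι z) - ((χ z : Circle) : ℂ) • (1 : S)) := by
          rw [smul_sub, smul_smul, h3, one_smul]
        rw [h4, norm_smul, Circle.norm_coe, one_mul]
        exact hpt z)
    simpa using h2
  have h4 : ∀ z : Z, (1 : PontryaginDual Z)⁻¹ z = 1 := fun z => by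
    change (1 : Circle)⁻¹ = 1
    simp
  have h1 : (1 : S) = ∫ _ : Z, (1 : S) ∂μ := by simp
  simp only [T, P, h4, Circle.coe_one, one_smul]
  conv_lhs => rw [h1]
  rw [← integral_sub (hint _ (hθ _)) (hint _ continuous_const)]
  have h2 := norm_integral_le_of_norm_le_const (μ := μ) (C := ε)
    (f := fun z => S.system.act (E.ι z) (F fun z => S.system.ellwoodMap t (E.ι z)) - (1 : S))
    (Filter.Eventually.of_forall fun z => by
      rw [← map_one (S.system.act (E.ι z)), ← map_sub, StarAlgEquiv.norm_map]
      exact hF)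
  simpa using h2


theorem dense_rinner (S : GHatStructure E α) (χ : PontryaginDual Z) :
    Dense (Submodule.span ℂ {a : A | ∃ x ∈ S.isotypic χ, ∃ y ∈ S.isotypic χ,
      S.incl a = star x * y} : Set A) := by
  have hmul : ∀ a : A, ∀ c ∈ Submodule.span ℂ {a : A | ∃ x ∈ S.isotypic χ,
      ∃ y ∈ S.isotypic χ, S.incl a = star x * y}, a * c ∈ Submodule.span ℂ {a : A |
      ∃ x ∈ S.isotypic χ, ∃ y ∈ S.isotypic χ, S.incl a = star x * y} := by
    intro a c hc
    induction hc using Submodule.span_induction with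
    | mem c hc =>
      obtain ⟨x, hx, y, hy, h⟩ := hc
      refine Submodule.subset_span ⟨x * S.incl (star a), mul_incl_mem _ hx, y, hy, ?_⟩
      rw [map_mul, h, star_mul, ← map_star, star_star, mul_assoc]
    | zero => simp
    | add c d _ _ hc hd => rw [mul_add]; exact Submodule.add_mem _ hc hd
    | smul z c _ hc => rw [mul_smul_comm]; exact Submodule.smul_mem _ _ hc
  intro a
  rw [Metric.mem_closure_iff]
  intro ε hε
  obtain ⟨c, hc, h⟩ := exists_near_one S χ (ε := ε / (‖a‖ + 1)) (by positivity)
  refine ⟨a * c, hmul a c hc, ?_⟩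
  have h1 : a - a * c = -(a * (c - 1)) := by rw [mul_sub, mul_one, neg_sub]
  rw [dist_eq_norm, h1, norm_neg]
  calc ‖a * (c - 1)‖ ≤ ‖a‖ * ‖c - 1‖ := norm_mul_le _ _
    _ ≤ ‖a‖ * (ε / (‖a‖ + 1)) := by gcongr
    _ < (‖a‖ + 1) * (ε / (‖a‖ + 1)) := by gcongr; linarith
    _ = ε := by field_simp

/-- The isotypic component `Â(χ)` as a Morita self-equivalence over `(A, Ĝ, α ∘ q)`, with the
bimodule structure given by multiplication, the inner products `x y*` and `x* y` and the action
given by `α̂`. -/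
noncomputable def isotypicMorita (S : GHatStructure E α) (χ : PontryaginDual Z) :
    MoritaSelfEquivalence (α.pullback E.q) where
  carrier := S.isotypic χ
  completeSpace := (isClosed_isotypic χ).completeSpace_coe
  left := S.isotypicLeft χ
  right := S.isotypicRight χ
  left_right a b x := Subtype.ext (mul_assoc _ _ _).symm
  linner := isotypicLinner
  rinner := isotypicRinner
  linner_add x y z := S.incl_injective <| by
    simp only [map_add, incl_isotypicLinner, Submodule.coe_add, add_mul]
  linner_left a x y := S.incl_injective <| by
    simp only [map_mul, incl_isotypicLinner]
    exact mul_assoc _ _ _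
  star_linner x y := S.incl_injective <| by
    simp only [map_star, incl_isotypicLinner, star_mul, star_star]
  linner_self x := exists_star_mul_self (x := star (x : S)) <| by
    rw [incl_isotypicLinner, star_star]
  rinner_add x y z := S.incl_injective <| by
    simp only [map_add, incl_isotypicRinner, Submodule.coe_add, mul_add]
  rinner_right a x y := S.incl_injective <| by
    simp only [map_mul, incl_isotypicRinner]
    exact (mul_assoc _ _ _).symm
  star_rinner x y := S.incl_injective <| by
    simp only [map_star, incl_isotypicRinner, star_mul, star_star]
  rinner_self x := exists_star_mul_self (x := (x : S)) (incl_isotypicRinner x x)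
  norm_linner x := by
    rw [← norm_incl (S := S), incl_isotypicLinner, CStarRing.norm_self_mul_star, sq]
    rfl
  norm_rinner x := by
    rw [← norm_incl (S := S), incl_isotypicRinner, CStarRing.norm_star_mul_self, sq]
    rfl
  linner_right a x y := S.incl_injective <| by
    simp only [incl_isotypicLinner, isotypicRight]
    simp [mul_assoc, map_star]
  rinner_left a x y := S.incl_injective <| by
    simp only [incl_isotypicRinner, isotypicLeft]
    simp [mul_assoc, map_star]
  left_linner x y z := Subtype.ext <| by
    change S.incl (isotypicLinner x y) * (z : S) = x * S.incl (isotypicRinner y z)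
    rw [incl_isotypicLinner, incl_isotypicRinner, mul_assoc]
  linner_full := by
    refine (dense_rinner S χ⁻¹).mono (Submodule.span_mono ?_)
    rintro a ⟨x, hx, y, hy, h⟩
    have hx' := star_mem_isotypic hx
    have hy' := star_mem_isotypic hy
    rw [inv_inv] at hx' hy'
    refine ⟨⟨star x, hx'⟩, ⟨star y, hy'⟩, S.incl_injective ?_⟩
    rw [incl_isotypicLinner, h, star_star]
  rinner_full := by
    refine (dense_rinner S χ).mono (Submodule.span_mono ?_)
    rintro a ⟨x, hx, y, hy, h⟩
    exact ⟨⟨x, hx⟩, ⟨y, hy⟩, S.incl_injective ((incl_isotypicRinner _ _).trans h.symm)⟩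
  act := S.isotypicAct χ
  continuous_act x := (S.system.continuous_act x).subtype_mk _
  linner_act g x y := S.incl_injective <| by
    change _ = S.incl (α.act (E.q g) _)
    rw [← S.act_incl, incl_isotypicLinner, incl_isotypicLinner, map_mul, map_star]
    rfl
  rinner_act g x y := S.incl_injective <| by
    change _ = S.incl (α.act (E.q g) _)
    rw [← S.act_incl, incl_isotypicRinner, incl_isotypicRinner, map_mul, map_star]
    rfl

/-- The underlying element of `Â`. -/
def val {S : GHatStructure E α} {χ : PontryaginDual Z} (x : S.isotypicMorita χ) : S :=
  Subtype.val (p := fun y => y ∈ S.isotypic χ) x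

/-- The multiplication map `m_(χ,χ') : Â(χ) × Â(χ') → Â(χχ')`, given on elementary tensors. -/
noncomputable def mulMap (S : GHatStructure E α) (χ χ' : PontryaginDual Z) :
    S.isotypicMorita χ →ₗ[ℂ] S.isotypicMorita χ' →ₗ[ℂ] S.isotypicMorita (χ * χ') :=
  S.isotypicMul χ χ'

theorem val_mulMap {S : GHatStructure E α} {χ χ' : PontryaginDual Z} (x : S.isotypicMorita χ)
    (y : S.isotypicMorita χ') : val (S.mulMap χ χ' x y) = val x * val y :=
  rfl

theorem val_mem {S : GHatStructure E α} {χ : PontryaginDual Z} (x : S.isotypicMorita χ) :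
    val x ∈ S.isotypic χ :=
  Subtype.property (p := fun y => y ∈ S.isotypic χ) x

theorem incl_linner {S : GHatStructure E α} {χ : PontryaginDual Z} (x y : S.isotypicMorita χ) :
    S.incl ((S.isotypicMorita χ).linner x y) = val x * star (val y) :=
  incl_isotypicLinner _ _

theorem incl_rinner {S : GHatStructure E α} {χ : PontryaginDual Z} (x y : S.isotypicMorita χ) :
    S.incl ((S.isotypicMorita χ).rinner x y) = star (val x) * val y :=
  incl_isotypicRinner _ _

theorem dense_mulMap (S : GHatStructure E α) (χ χ' : PontryaginDual Z) :
    Dense (Submodule.span ℂ {z | ∃ x y, S.mulMap χ χ' x y = z} :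
      Set (S.isotypicMorita (χ * χ'))) := by
  intro z
  have hmul : ∀ c ∈ Submodule.span ℂ {a : A | ∃ x ∈ S.isotypic χ',
      ∃ y ∈ S.isotypic χ', S.incl a = star x * y},
      (S.isotypicMorita (χ * χ')).right (op c) z ∈
        Submodule.span ℂ {z | ∃ x y, S.mulMap χ χ' x y = z} := by
    intro c hc
    induction hc using Submodule.span_induction with
    | mem c hc =>
      obtain ⟨x, hx, y, hy, h⟩ := hc
      have h1 : val z * star x ∈ S.isotypic χ := by
        simpa using mul_mem_isotypic (val_mem z) (star_mem_isotypic hx)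
      refine Submodule.subset_span ⟨(⟨val z * star x, h1⟩ : S.isotypic χ),
        (⟨y, hy⟩ : S.isotypic χ'), Subtype.ext ?_⟩
      change val z * star x * y = val z * S.incl c
      rw [h, mul_assoc]
    | zero => rw [op_zero, map_zero]; exact Submodule.zero_mem _
    | add c d _ _ hc hd =>
      rw [op_add, map_add, LinearMap.add_apply]
      exact Submodule.add_mem _ hc hd
    | smul w c _ hc =>
      rw [op_smul, map_smul, LinearMap.smul_apply]
      exact Submodule.smul_mem _ _ hc
  rw [Metric.mem_closure_iff]
  intro ε hε
  obtain ⟨c, hc, h⟩ := exists_near_one S χ' (ε := ε / (‖val z‖ + 1)) (by positivity)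
  refine ⟨_, hmul c hc, ?_⟩
  change dist (val z) (val z * S.incl c) < ε
  have h1 : val z - val z * S.incl c = -(val z * S.incl (c - 1)) := by
    rw [map_sub, map_one, mul_sub, mul_one, neg_sub]
  rw [dist_eq_norm, h1, norm_neg]
  calc ‖val z * S.incl (c - 1)‖ ≤ ‖val z‖ * ‖c - 1‖ := by
        rw [← norm_incl (S := S) (c - 1)]; exact norm_mul_le _ _
    _ ≤ ‖val z‖ * (ε / (‖val z‖ + 1)) := by gcongr
    _ < (‖val z‖ + 1) * (ε / (‖val z‖ + 1)) := by gcongr; linarith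
    _ = ε := by field_simp

theorem isInternalTensor_mulMap (S : GHatStructure E α) (χ χ' : PontryaginDual Z) :
    MoritaSelfEquivalence.IsInternalTensor (S.isotypicMorita χ) (S.isotypicMorita χ')
      (S.isotypicMorita (χ * χ')) (S.mulMap χ χ') where
  balanced _ _ _ := Subtype.ext (mul_assoc _ _ _)
  left_apply _ _ _ := Subtype.ext (mul_assoc _ _ _).symm
  right_apply _ _ _ := Subtype.ext (mul_assoc _ _ _)
  act_apply _ _ _ := Subtype.ext (map_mul _ _ _)
  linner_apply x y x' y' := S.incl_injective <| by
    rw [incl_linner, incl_linner, val_mulMap, val_mulMap]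
    change _ = val x * S.incl ((S.isotypicMorita χ').linner y y') * star (val x')
    rw [incl_linner, star_mul]
    simp only [mul_assoc]
  rinner_apply x y x' y' := S.incl_injective <| by
    rw [incl_rinner, incl_rinner, val_mulMap, val_mulMap]
    change _ = star (val y) * (S.incl ((S.isotypicMorita χ).rinner x x') * val y')
    rw [incl_rinner, star_mul]
    simp only [mul_assoc]
  dense_span := S.dense_mulMap χ χ'

/-- The Picard homomorphism `χ ↦ [Â(χ)]` of a `Ĝ`-structure. -/
noncomputable def picard (S : GHatStructure E α) :
    PicHom (PontryaginDual Z) (α.pullback E.q) where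
  toFun χ := (S.isotypicMorita χ).cls
  map_mul χ χ' := ⟨_, _, _, _, rfl, rfl, rfl, S.isInternalTensor_mulMap χ χ'⟩

end Fullness

end GHatStructure

/-- The set `Ext(Ĝ, (A, G, α))` of equivalence classes of `Ĝ`-structures. -/
def Ext (E : CentralExtension Z Gh G) (α : CStarSystem G A) : Type _ :=
  Quotient (GHatStructure.setoid E α)

/-- The class of a `Ĝ`-structure in `Ext(Ĝ, (A, G, α))`. -/
def GHatStructure.cls {E : CentralExtension Z Gh G} {α : CStarSystem G A}
    (S : GHatStructure E α) : Ext E α :=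
  Quotient.mk _ S

variable [IsTopologicalGroup Z] [CompactSpace Z] [CompactSpace Gh] [T2Space Gh]
  {E : CentralExtension Z Gh G} {α : CStarSystem G A}

/-- The set `Ext(Ĝ, (A, G, α), p)` of the classes of `Ĝ`-structures with Picard homomorphism `p`. -/
def ExtOver (p : PicHom (PontryaginDual Z) (α.pullback E.q)) : Set (Ext E α) :=
  {c | ∃ S : GHatStructure E α, S.cls = c ∧ S.picard = p}

/-- `A` itself as a Morita self-equivalence. -/
noncomputable def MoritaSelfEquivalence.unit {H : Type*} [Group H] [TopologicalSpace H]
    (β : CStarSystem H A) : MoritaSelfEquivalence β where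
  carrier := A
  left := Algebra.lmul ℂ A
  right :=
    { toFun := fun a => LinearMap.mulRight ℂ a.unop
      map_one' := by ext x; simp
      map_mul' := fun a b => by ext x; simp [mul_assoc]
      map_zero' := by ext x; simp
      map_add' := fun a b => by ext x; simp [mul_add]
      commutes' := fun c => by ext x; simp [Algebra.algebraMap_eq_smul_one] }
  left_right a b x := (mul_assoc _ _ _).symm
  linner x y := x * star y
  rinner x y := star x * y
  linner_add _ _ _ := add_mul _ _ _
  linner_left _ _ _ := mul_assoc _ _ _
  star_linner x y := by simp
  linner_self x := ⟨star x, by simp⟩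
  rinner_add _ _ _ := mul_add _ _ _
  rinner_right _ _ _ := (mul_assoc _ _ _).symm
  star_rinner x y := by simp
  rinner_self x := ⟨x, rfl⟩
  norm_linner x := by rw [CStarRing.norm_self_mul_star, sq]
  norm_rinner x := by rw [CStarRing.norm_star_mul_self, sq]
  linner_right a x y := by simp [mul_assoc]
  rinner_left a x y := by simp [mul_assoc]
  left_linner x y z := by simp [mul_assoc]
  linner_full := by
    refine dense_univ.mono fun a _ => Submodule.subset_span ⟨a, 1, by simp⟩
  rinner_full := by
    refine dense_univ.mono fun a _ => Submodule.subset_span ⟨1, a, by simp⟩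
  act :=
    { toFun := fun h =>
        { toFun := fun x => β.act h x
          map_add' := map_add _
          map_smul' := map_smul _
          invFun := fun x => β.act h⁻¹ x
          left_inv := fun x => by simp [← StarAlgEquiv.mul_apply]
          right_inv := fun x => by simp [← StarAlgEquiv.mul_apply] }
      map_one' := by ext x; simp
      map_mul' := fun g h => by ext x; simp }
  continuous_act := β.continuous_act
  linner_act h x y := by simp [map_star]
  rinner_act h x y := by simp [map_star]

/-- A `Ĝ`-structure whose `Z`-isotypic components are the given `M(χ)`: a `Ĝ`-structure with
identifications of the Morita self-equivalences `M(χ)` and `Â(χ)` for all `χ`. Here `M(1)` is `A`,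
by means of `e₀`, and is included in `Â` as such. -/
structure StructureOn (M : PontryaginDual Z → MoritaSelfEquivalence (α.pullback E.q))
    (e₀ : (MoritaSelfEquivalence.unit (α.pullback E.q)).Iso (M 1))
    extends GHatStructure E α where
  comp : ∀ χ, (M χ).Iso (toGHatStructure.isotypicMorita χ)
  comp_one : ∀ a : A, GHatStructure.val (comp 1 (e₀ a)) = toGHatStructure.incl a

namespace StructureOn

variable {M : PontryaginDual Z → MoritaSelfEquivalence (α.pullback E.q)}
  {e₀ : (MoritaSelfEquivalence.unit (α.pullback E.q)).Iso (M 1)}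

/-- The multiplication map `m_(χ,χ') : M(χ) × M(χ') → M(χχ')`, given on elementary tensors. -/
noncomputable def mul (T : StructureOn M e₀) (χ χ' : PontryaginDual Z) (x : M χ) (y : M χ') :
    M (χ * χ') :=
  (T.comp (χ * χ')).symm (T.mulMap χ χ' (T.comp χ x) (T.comp χ' y))

/-- `m'_(χ,χ') = ω(χ,χ') m_(χ,χ')` for all `χ, χ'`, where `ω(χ,χ')` acts on `M(χχ')` from the
left. -/
def DifferBy (T T' : StructureOn M e₀)
    (ω : PontryaginDual Z × PontryaginDual Z → (α.pullback E.q).centralUnitary) : Prop :=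
  ∀ χ χ' x y, T'.mul χ χ' x y =
    (M (χ * χ')).left ((ω (χ, χ') : unitary A) : A) (T.mul χ χ' x y)

end StructureOn

end Structures

end CStarLift

/-! Let two structures share the components `M χ`. On products of elements of `M χ` and `M χ'`, both
inner products of `M (χ * χ')` are given by formulas that involve only the bimodules, not the
multiplication. So the two multiplications give two families in `M (χ * χ')` with the same inner
products, compatible with the left action of `A` and with the group action. Fullness forces two such
families to differ by an invariant central unitary (`exists_centralUnitary_of_family`), and this
unitary is `ω (χ, χ')`. Bracketing a triple product in two ways gives the cocycle identity; the
automorphism `Δ χ` appears when `ω (χ', χ'')` is moved to the left past an element of `M χ`.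

An equivalence fixes `A` and preserves isotypic components, so by the same lemma it is on each `M χ`
the multiplication by some `v χ`. Multiplicativity then reads `v (χ * χ') = v χ * Δ χ (v χ') * ω (χ,
χ')`, which says that `ω` is the coboundary of `v⁻¹`.

Conversely, such a `v` gives maps between isotypic components that respect products and adjoints.
The analytic point is to extend them to the whole C*-algebras without a norm estimate on sums of
components. This is done with the graph (`exists_starAlgEquiv_of_graph`): its closure is a
C*-subalgebra of the product, both coordinate projections are injective on it, and injective
*-homomorphisms of C*-algebras are isometric, hence have closed range.

Injectivity and surjectivity of these projections rest on Fourier analysis for the compact abelian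
group `Z`: an element lies in a closed subspace as soon as all its spectral projections do.
Hahn-Banach reduces this to scalar functions, where it says that a nonzero continuous function has a
nonzero Fourier coefficient. That fact comes from Gelfand theory: convolution by `f` on `L²` lies in
the commutative C*-algebra that is the bicommutant of the translations, and a Gelfand character that
does not vanish there restricts to a character of `Z`. -/

namespace CStarLift

/-! ## Fourier coefficients on compact abelian groups -/

section Fourier

open MeasureTheory WeakDual

/-- A strongly continuous unitary representation of a compact abelian group: if the operator
`∫ f(z) U_z dz` does not vanish, then some Fourier coefficient of `f` does not vanish. -/
theorem exists_character_integral_ne_zero {Z : Type*} [CommGroup Z] [TopologicalSpace Z]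
    [IsTopologicalGroup Z] [CompactSpace Z] [MeasurableSpace Z] [BorelSpace Z]
    (μ : Measure Z) [IsProbabilityMeasure μ] [μ.IsMulLeftInvariant]
    {H : Type*} [NormedAddCommGroup H] [InnerProductSpace ℂ H] [CompleteSpace H]
    (U : Z →* (H →L[ℂ] H)) (hU : ∀ z, star (U z) = U z⁻¹)
    (hUc : ∀ ξ, Continuous fun z => U z ξ) (hUn : ∀ z ξ, ‖U z ξ‖ = ‖ξ‖)
    (f : C(Z, ℂ)) (R : H →L[ℂ] H) (hR : ∀ ξ, R ξ = ∫ z, f z • U z ξ ∂μ) (hR0 : R ≠ 0) :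
    ∃ χ : PontryaginDual Z, ∫ z, ((χ z : Circle) : ℂ) * f z ∂μ ≠ 0 := by
  have hint : ∀ {E : Type _} [NormedAddCommGroup E] (g : Z → E), Continuous g → Integrable g μ :=
    fun g hg => hg.integrable_of_hasCompactSupport (HasCompactSupport.of_compactSpace g)
  have hfU : ∀ ξ, Continuous fun z => f z • U z ξ := fun ξ => f.continuous.smul (hUc ξ)
  -- The bicommutant of the operators `U z` is norm closed, contains every `U z` and also their
  -- strong integral `R`, and is commutative because `Z` is.
  let C : StarSubalgebra ℂ (H →L[ℂ] H) :=
    StarSubalgebra.centralizer ℂ (StarSubalgebra.centralizer ℂ (Set.range U) : Set (H →L[ℂ] H))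
  have hcent : ∀ T, T ∈ StarSubalgebra.centralizer ℂ (Set.range U) ↔ ∀ z, U z * T = T * U z := by
    intro T
    rw [StarSubalgebra.mem_centralizer_iff]
    refine ⟨fun h z => (h _ ⟨z, rfl⟩).1, ?_⟩
    rintro h _ ⟨z, rfl⟩
    exact ⟨h z, by rw [hU, h]⟩
  have hmemC : ∀ T, T ∈ C ↔ ∀ S ∈ StarSubalgebra.centralizer ℂ (Set.range U), S * T = T * S := by
    intro T
    rw [StarSubalgebra.mem_centralizer_iff]
    exact ⟨fun h S hS => (h S hS).1, fun h S hS => ⟨h S hS, h _ (star_mem hS)⟩⟩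
  have hUC : ∀ z, U z ∈ C := fun z => (hmemC _).mpr fun S hS => ((hcent S).mp hS z).symm
  have hcomm : ∀ S ∈ C, ∀ T ∈ C, S * T = T * S := by
    intro S hS T hT
    refine (hmemC T).mp hT S ((hcent S).mpr fun z => ?_)
    refine (hmemC S).mp hS (U z) ((hcent _).mpr fun w => ?_)
    rw [← map_mul, ← map_mul, mul_comm]
  have hRC : R ∈ C := by
    refine (hmemC R).mpr fun S hS => ContinuousLinearMap.ext fun ξ => ?_
    rw [mul_apply_eq_comp, mul_apply_eq_comp, hR, hR,
      ← S.integral_comp_comm (hint _ (hfU ξ))]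
    refine integral_congr_ae (Filter.Eventually.of_forall fun z => ?_)
    have := congrArg (fun T : H →L[ℂ] H => T ξ) ((hcent S).mp hS z)
    simp only [mul_apply_eq_comp] at this
    simp only [map_smul, this]
  have : IsClosed (C : Set (H →L[ℂ] H)) := by
    rw [StarSubalgebra.coe_centralizer]
    exact Set.isClosed_centralizer _
  let _ : CommCStarAlgebra C :=
    { (inferInstance : CStarAlgebra C) with
      mul_comm := fun S T => Subtype.ext (hcomm S S.2 T T.2) }
  let u : Z → C := fun z => ⟨U z, hUC z⟩
  let r : C := ⟨R, hRC⟩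
  have hr0 : r ≠ 0 := fun h => hR0 (congrArg Subtype.val h)
  -- The Gelfand transform of a commutative C*-algebra is injective, so some character sees `r`.
  obtain ⟨φ, hφ⟩ : ∃ φ : characterSpace ℂ C, φ r ≠ 0 := by
    by_contra! h
    refine hr0 ((gelfandTransform_isometry C).injective ?_)
    rw [map_zero]
    ext φ
    exact h φ
  -- `z ↦ U_z R` is continuous in norm
  have hker : ∀ w ξ, U w (R ξ) = ∫ z, f (w⁻¹ * z) • U z ξ ∂μ := by
    intro w ξ
    rw [hR, ← (U w).integral_comp_comm (hint _ (hfU ξ)),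
      ← integral_mul_left_eq_self (fun z => f (w⁻¹ * z) • U z ξ) w]
    refine integral_congr_ae (Filter.Eventually.of_forall fun z => ?_)
    simp only [map_smul, inv_mul_cancel_left, map_mul, mul_apply_eq_comp]
  have hcont : Continuous fun z => u z * r := by
    -- `U w * R` is the operator attached to the translate of `f` by `w`. The translate depends
    -- continuously on `w` in the sup norm, and the sup norm dominates the operator norm.
    let F : C(Z, C(Z, ℂ)) :=
      ContinuousMap.curry ⟨fun p : Z × Z => f (p.1⁻¹ * p.2), by fun_prop⟩
    rw [continuous_iff_continuousAt]
    intro w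
    rw [ContinuousAt, tendsto_iff_norm_sub_tendsto_zero]
    have h0 : Filter.Tendsto (fun z => ‖F z - F w‖) (nhds w) (nhds 0) :=
      tendsto_iff_norm_sub_tendsto_zero.mp (F.continuous.tendsto w)
    refine squeeze_zero (fun _ => norm_nonneg _) (fun z => ?_) h0
    refine ContinuousLinearMap.opNorm_le_bound _ (norm_nonneg _) fun ξ => ?_
    have hcg : ∀ v : Z, Continuous fun z => f (v⁻¹ * z) • U z ξ := fun v =>
      (by fun_prop : Continuous fun z => f (v⁻¹ * z)).smul (hUc ξ)
    change ‖U z (R ξ) - U w (R ξ)‖ ≤ _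
    rw [hker, hker, ← integral_sub (hint _ (hcg z)) (hint _ (hcg w))]
    have h2 := norm_integral_le_of_norm_le_const (μ := μ) (C := ‖F z - F w‖ * ‖ξ‖)
      (f := fun x => f (z⁻¹ * x) • U x ξ - f (w⁻¹ * x) • U x ξ)
      (Filter.Eventually.of_forall fun x => by
        rw [← sub_smul, norm_smul, hUn]
        gcongr
        exact (F z - F w).norm_coe_le_norm x)
    simpa using h2
  have humul : ∀ z w, u (z * w) = u z * u w := fun z w => Subtype.ext (map_mul U z w)
  have hunit : ∀ z, star (u z) * u z = 1 := fun z => Subtype.ext <| by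
    change star (U z) * U z = 1
    rw [hU, ← map_mul, inv_mul_cancel, map_one]
  have hnorm : ∀ z, ‖φ (u z)‖ = 1 := by
    intro z
    have h1 := congrArg φ (hunit z)
    rw [map_mul, map_star, map_one] at h1
    have h2 := congrArg norm h1
    rw [norm_mul, norm_star, norm_one] at h2
    nlinarith [norm_nonneg (φ (u z))]
  -- Only strong continuity of `u` is available, while `φ` is norm continuous; multiplying by `r`
  -- and dividing by `φ r ≠ 0` bridges the gap.
  have hφc : Continuous fun z => φ (u z) := by
    have : (fun z => φ (u z)) = fun z => φ (u z * r) / φ r := by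
      ext z
      rw [map_mul, mul_div_cancel_right₀ _ hφ]
    rw [this]
    exact ((map_continuous φ).comp hcont).div_const _
  let χ : Z →ₜ* Circle :=
    { toFun := fun z => ⟨φ (u z), mem_sphere_zero_iff_norm.mpr (hnorm z)⟩
      map_one' := Subtype.ext <| by
        have : u 1 = 1 := Subtype.ext (map_one U)
        simp [this]
      map_mul' := fun z w => Subtype.ext ((congrArg φ (humul z w)).trans (map_mul φ _ _))
      continuous_toFun := hφc.subtype_mk _ }
  refine ⟨χ, ?_⟩
  have hint' : Integrable (fun z => f z • (u z * r)) μ := hint _ (f.continuous.smul hcont)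
  -- The factor `r` makes the integrand norm continuous, so the integral exists in `C` and `φ` may
  -- be taken inside. This gives `φ r * φ r = (∫ χ f) * φ r`, so a vanishing coefficient would force
  -- `φ r = 0`.
  have hrr : r * r = ∫ z, f z • (u z * r) ∂μ := by
    apply Subtype.ext
    let L : C →L[ℂ] (H →L[ℂ] H) := ⟨C.subtype.toLinearMap, continuous_subtype_val⟩
    have h1 := L.integral_comp_comm hint'
    refine Eq.trans ?_ h1
    ext ξ
    rw [ContinuousLinearMap.integral_apply (L.integrable_comp hint')]
    exact hR (R ξ)
  have h1 := congrArg φ hrr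
  have h2 := (CharacterSpace.toCLM φ).integral_comp_comm hint'
  have h3 : φ (∫ z, f z • (u z * r) ∂μ) = (∫ z, ((χ z : Circle) : ℂ) * f z ∂μ) * φ r := by
    refine (h2.symm).trans ?_
    rw [← integral_mul_const]
    refine integral_congr_ae (Filter.Eventually.of_forall fun z => ?_)
    change φ (f z • (u z * r)) = φ (u z) * f z * φ r
    rw [map_smul, map_mul, smul_eq_mul]
    ring
  intro h4
  erw [h4] at h3
  rw [h1.symm, map_mul, zero_mul] at h3
  exact hφ (mul_self_eq_zero.mp h3)

/-- The Fourier coefficients of a nonzero continuous function on a compact abelian group do not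
all vanish. -/
theorem exists_fourierCoeff_ne_zero {Z : Type*} [CommGroup Z] [TopologicalSpace Z]
    [IsTopologicalGroup Z] [CompactSpace Z] [MeasurableSpace Z] [BorelSpace Z]
    (μ : Measure Z) [IsProbabilityMeasure μ] [μ.IsHaarMeasure] [μ.InnerRegularCompactLTTop]
    (f : C(Z, ℂ)) (hf : f ≠ 0) :
    ∃ χ : PontryaginDual Z, ∫ z, ((χ z : Circle) : ℂ) * f z ∂μ ≠ 0 := by
  have hint : ∀ {E : Type _} [NormedAddCommGroup E] (g : Z → E), Continuous g → Integrable g μ :=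
    fun g hg => hg.integrable_of_hasCompactSupport (HasCompactSupport.of_compactSpace g)
  let U : Z →* (Lp ℂ 2 μ →L[ℂ] Lp ℂ 2 μ) :=
    { toFun := fun z => LinearMap.mkContinuous
        { toFun := fun ξ => DomMulAct.mk z • ξ
          map_add' := smul_add _
          map_smul' := fun c ξ => smul_comm _ _ _ } 1
          (fun ξ => by rw [one_mul]; exact (DomMulAct.norm_smul_Lp _ _).le)
      map_one' := by
        ext1 ξ
        exact one_smul (Zᵈᵐᵃ) ξ
      -- Precomposition with translations reverses products, which is harmless because `Z` is
      -- commutative.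
      map_mul' := fun z w => by
        ext1 ξ
        rw [mul_comm z w]
        exact mul_smul (DomMulAct.mk z) (DomMulAct.mk w) ξ }
  have hUn : ∀ z ξ, ‖U z ξ‖ = ‖ξ‖ := fun z ξ => DomMulAct.norm_smul_Lp _ _
  have hUU : ∀ z ξ, U z (U z⁻¹ ξ) = ξ := fun z ξ => by
    rw [← mul_apply_eq_comp, ← map_mul, mul_inv_cancel, map_one]
    rfl
  have hU : ∀ z, star (U z) = U z⁻¹ := by
    intro z
    refine ((ContinuousLinearMap.eq_adjoint_iff _ _).mpr fun ξ η => ?_).symm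
    have := LinearIsometry.inner_map_map (⟨(U z).toLinearMap, hUn z⟩ : _ →ₗᵢ[ℂ] _) (U z⁻¹ ξ) η
    refine this.symm.trans ?_
    change inner ℂ (U z (U z⁻¹ ξ)) (U z η) = _
    rw [hUU]
  have : Fact ((2 : ENNReal) ≠ ⊤) := ⟨ENNReal.ofNat_ne_top⟩
  have hUc : ∀ ξ, Continuous fun z => U z ξ := fun ξ =>
    (DomMulAct.continuous_mk).smul continuous_const
  have hfU : ∀ ξ, Continuous fun z => f z • U z ξ := fun ξ => f.continuous.smul (hUc ξ)
  let R : Lp ℂ 2 μ →L[ℂ] Lp ℂ 2 μ := LinearMap.mkContinuous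
    { toFun := fun ξ => ∫ z, f z • U z ξ ∂μ
      map_add' := fun ξ η => by
        rw [← integral_add (hint _ (hfU ξ)) (hint _ (hfU η))]
        simp only [map_add, smul_add]
      map_smul' := fun c ξ => by
        rw [← integral_smul]
        simp only [map_smul, RingHom.id_apply, smul_comm c] } ‖f‖ fun ξ => by
    have h2 := norm_integral_le_of_norm_le_const (μ := μ) (C := ‖f‖ * ‖ξ‖)
      (f := fun z => f z • U z ξ) (Filter.Eventually.of_forall fun z => by
        rw [norm_smul, hUn]
        gcongr
        exact f.norm_coe_le_norm z)
    simpa using h2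
  refine exists_character_integral_ne_zero μ U hU hUc hUn f R (fun _ => rfl) fun hR0 => hf ?_
  -- If `R` vanished, so would its value at the conjugate of `f`. That value is the class of a
  -- continuous function whose value at `1` is the integral of `‖f‖ ^ 2`.
  let F : C(Z, C(Z, ℂ)) := ContinuousMap.curry ⟨fun p : Z × Z => star (f (p.1 * p.2)), by fun_prop⟩
  have hFc : Continuous fun z => f z • F z := f.continuous.smul F.continuous
  have h1 : R (ContinuousMap.toLp 2 μ ℂ (star f)) =
      ContinuousMap.toLp 2 μ ℂ (∫ z, f z • F z ∂μ) := by
    rw [← (ContinuousMap.toLp 2 μ ℂ).integral_comp_comm (hint _ hFc)]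
    refine integral_congr_ae (Filter.Eventually.of_forall fun z => ?_)
    simp only [map_smul]
    rfl
  rw [hR0, zero_apply, eq_comm,
    map_eq_zero_iff _ (ContinuousMap.toLp_injective μ)] at h1
  have h2 : ∫ z, ‖f z‖ ^ 2 ∂μ = 0 := by
    have h3 := congrArg (ContinuousMap.evalCLM ℂ (1 : Z)) h1
    rw [← ContinuousLinearMap.integral_comp_comm _ (hint _ hFc), map_zero] at h3
    have h4 : ∀ z, ContinuousMap.evalCLM ℂ (1 : Z) (f z • F z) = ((‖f z‖ ^ 2 : ℝ) : ℂ) := by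
      intro z
      have : ContinuousMap.evalCLM ℂ (1 : Z) (f z • F z) = f z * star (f (z * 1)) := rfl
      rw [this, mul_one, Complex.star_def, Complex.mul_conj, Complex.normSq_eq_norm_sq]
    simp only [h4] at h3
    exact Complex.ofReal_injective ((integral_ofReal (𝕜 := ℂ)).symm.trans h3)
  by_contra hf0
  obtain ⟨z, hz⟩ : ∃ z, f z ≠ 0 := by
    by_contra! h
    exact hf0 (ContinuousMap.ext h)
  have hcont : Continuous fun z => ‖f z‖ ^ 2 := by fun_prop
  refine (hcont.integral_pos_of_hasCompactSupport_nonneg_nonzero (μ := μ)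
    (HasCompactSupport.of_compactSpace _) (fun z => by positivity) (x := z) ?_).ne' h2
  simpa using hz

end Fourier

/-! ## Spectral subspaces of an action of a compact abelian group -/

section Spectral

open MeasureTheory

variable {Z : Type*} [CommGroup Z] [TopologicalSpace Z]

/-- Otherwise Hahn-Banach on `X ⧸ W` provides a functional that does not vanish at the class of some
`g z`. Composed with `g` it is a nonzero continuous scalar function all of whose Fourier
coefficients vanish. -/
theorem mem_of_forall_integral_mem [IsTopologicalGroup Z] [CompactSpace Z] [MeasurableSpace Z]
    [BorelSpace Z] (μ : Measure Z) [IsProbabilityMeasure μ] [μ.IsHaarMeasure]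
    [μ.InnerRegularCompactLTTop] {X : Type*} [NormedAddCommGroup X] [NormedSpace ℂ X]
    [CompleteSpace X] (W : Submodule ℂ X) (hW : IsClosed (W : Set X)) {g : Z → X}
    (hg : Continuous g) (h : ∀ χ : PontryaginDual Z, ∫ z, ((χ z : Circle) : ℂ) • g z ∂μ ∈ W)
    (z : Z) : g z ∈ W := by
  have : IsClosed (W : Set X) := hW
  let Q : X →L[ℂ] X ⧸ W := ⟨W.mkQ, continuous_quot_mk⟩
  have hQ : ∀ x, Q x = 0 ↔ x ∈ W := fun x => W.mkQ_apply x ▸ Submodule.Quotient.mk_eq_zero W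
  rw [← hQ]
  refine SeparatingDual.eq_zero_of_forall_dual_eq_zero (R := ℂ) fun φ => ?_
  by_contra hne
  let f : C(Z, ℂ) := ⟨fun z => φ (Q (g z)), by fun_prop⟩
  obtain ⟨χ, hχ⟩ := exists_fourierCoeff_ne_zero μ f fun hf => hne (congrArg (fun f => f z) hf)
  apply hχ
  have hχc : Continuous fun z => ((χ z : Circle) : ℂ) :=
    continuous_induced_dom.comp (map_continuous χ)
  have hint : Integrable (fun z => ((χ z : Circle) : ℂ) • g z) μ :=
    (hχc.smul hg).integrable_of_hasCompactSupport (HasCompactSupport.of_compactSpace _)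
  have h1 := (φ.comp Q).integral_comp_comm hint
  rw [ContinuousLinearMap.comp_apply, (hQ _).mpr (h χ), map_zero] at h1
  refine Eq.trans (integral_congr_ae (Filter.Eventually.of_forall fun z => ?_)) h1
  simp only [map_smul]
  rfl

namespace CStarSystem

variable {X Y : Type*} [CStarAlgebra X] [CStarAlgebra Y]

/-- The spectral subspace of a character. -/
def spectral (θ : CStarSystem Z X) (χ : PontryaginDual Z) : Submodule ℂ X where
  carrier := {x | ∀ z, θ.act z x = ((χ z : Circle) : ℂ) • x}
  add_mem' hx hy z := by rw [map_add, hx z, hy z, smul_add]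
  zero_mem' z := by simp
  smul_mem' c x hx z := by rw [map_smul, hx z, smul_comm]

theorem continuous_smul_act (θ : CStarSystem Z X) (χ : PontryaginDual Z) (x : X) :
    Continuous fun z => ((χ z : Circle) : ℂ) • θ.act z x :=
  (continuous_induced_dom.comp (map_continuous χ)).smul (θ.continuous_act x)

variable [CompactSpace Z] [MeasurableSpace Z] [BorelSpace Z]
  (μ : Measure Z) [IsProbabilityMeasure μ]

theorem integrable_smul_act (θ : CStarSystem Z X) (χ : PontryaginDual Z) (x : X) :
    Integrable (fun z => ((χ z : Circle) : ℂ) • θ.act z x) μ :=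
  (θ.continuous_smul_act χ x).integrable_of_hasCompactSupport
    (HasCompactSupport.of_compactSpace _)

/-- The projection onto the spectral subspace of a character. -/
noncomputable def spectralProj (θ : CStarSystem Z X) (χ : PontryaginDual Z) : X →L[ℂ] X :=
  LinearMap.mkContinuous
    { toFun := fun x => ∫ z, ((χ⁻¹ z : Circle) : ℂ) • θ.act z x ∂μ
      map_add' := fun x y => by
        rw [← integral_add (θ.integrable_smul_act μ _ x) (θ.integrable_smul_act μ _ y)]
        simp only [map_add, smul_add]
      map_smul' := fun c x => by
        rw [← integral_smul]
        simp only [map_smul, RingHom.id_apply, smul_comm c] } 1 fun x => by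
    have h := norm_integral_le_of_norm_le_const (μ := μ) (C := ‖x‖)
      (f := fun z => ((χ⁻¹ z : Circle) : ℂ) • θ.act z x) (Filter.Eventually.of_forall fun z => by
        rw [norm_smul, Circle.norm_coe, one_mul, StarAlgEquiv.norm_map])
    simpa using h

theorem spectralProj_apply (θ : CStarSystem Z X) (χ : PontryaginDual Z) (x : X) :
    θ.spectralProj μ χ x = ∫ z, ((χ⁻¹ z : Circle) : ℂ) • θ.act z x ∂μ :=
  rfl

theorem spectralProj_of_mem {θ : CStarSystem Z X} {χ : PontryaginDual Z} {x : X}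
    (hx : x ∈ θ.spectral χ) : θ.spectralProj μ χ x = x := by
  have h : ∀ z, ((χ⁻¹ z : Circle) : ℂ) • θ.act z x = x := fun z => by
    have h1 : χ⁻¹ z * χ z = 1 := inv_mul_cancel (χ z)
    rw [hx z, smul_smul, ← Circle.coe_mul, h1, Circle.coe_one, one_smul]
  rw [spectralProj_apply]
  simp [h]

variable [IsTopologicalGroup Z]

theorem spectralProj_mem [μ.IsMulLeftInvariant] (θ : CStarSystem Z X) (χ : PontryaginDual Z)
    (x : X) : θ.spectralProj μ χ x ∈ θ.spectral χ := by
  intro w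
  let L : X →L[ℂ] X := ⟨((θ.act w : X ≃⋆ₐ[ℂ] X) : X →⋆ₐ[ℂ] X).toLinearMap,
    (StarAlgEquiv.isometry (θ.act w)).continuous⟩
  have hL : ∀ y, θ.act w y = L y := fun y => rfl
  rw [spectralProj_apply, hL, ← L.integral_comp_comm (θ.integrable_smul_act μ χ⁻¹ x),
    ← integral_smul, ← integral_mul_left_eq_self (fun z => ((χ w : Circle) : ℂ) •
      ((χ⁻¹ z : Circle) : ℂ) • θ.act z x) w]
  refine integral_congr_ae (Filter.Eventually.of_forall fun z => ?_)
  have h1 : χ w * χ⁻¹ (w * z) = χ⁻¹ z := by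
    change χ w * (χ (w * z))⁻¹ = (χ z)⁻¹
    rw [map_mul, mul_inv, mul_inv_cancel_left]
  simp only
  rw [map_smul, ← hL, smul_smul, ← Circle.coe_mul, h1, map_mul, StarAlgEquiv.mul_apply]

/-- The projection of `x` is a scalar multiple of `x`, so it lies in the spectral subspaces of both
`χ` and `ψ`, and these meet in zero when the characters differ. No orthogonality relation for
characters has to be known beforehand. -/
theorem spectralProj_of_mem_ne [μ.IsMulLeftInvariant] {θ : CStarSystem Z X}
    {χ ψ : PontryaginDual Z} (hne : χ ≠ ψ) {x : X} (hx : x ∈ θ.spectral ψ) :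
    θ.spectralProj μ χ x = 0 := by
  obtain ⟨w, hw⟩ : ∃ w, χ w ≠ ψ w := by
    by_contra! h
    exact hne (PontryaginDual.ext h)
  have h1 : θ.spectralProj μ χ x ∈ θ.spectral ψ := by
    have h2 : θ.spectralProj μ χ x = (∫ z, ((χ⁻¹ z : Circle) : ℂ) * (ψ z : Circle) ∂μ) • x := by
      rw [spectralProj_apply, ← integral_smul_const]
      refine integral_congr_ae (Filter.Eventually.of_forall fun z => ?_)
      simp only
      rw [hx z, smul_smul]
    rw [h2]
    exact Submodule.smul_mem _ _ hx
  have h3 : ((χ w : ℂ) - (ψ w : ℂ)) • θ.spectralProj μ χ x = 0 := by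
    rw [sub_smul, ← h1 w, θ.spectralProj_mem μ χ x w, sub_self]
  exact (smul_eq_zero.mp h3).resolve_left fun h => hw (Circle.coe_injective (sub_eq_zero.mp h))

variable [μ.IsHaarMeasure] [μ.InnerRegularCompactLTTop]

/-- The Fourier coefficients of the orbit map `z ↦ θ.act z x` are the spectral projections of `x`,
with `χ` replaced by its inverse; the value of the orbit map at `1` is `x`. -/
theorem mem_of_forall_spectralProj_mem (θ : CStarSystem Z X) (W : Submodule ℂ X)
    (hW : IsClosed (W : Set X)) {x : X} (h : ∀ χ, θ.spectralProj μ χ x ∈ W) : x ∈ W := by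
  have := mem_of_forall_integral_mem μ W hW (θ.continuous_act x) (fun χ => ?_) 1
  · simpa using this
  · simpa [spectralProj_apply] using h χ⁻¹

theorem eq_zero_of_forall_spectralProj (θ : CStarSystem Z X) {x : X}
    (h : ∀ χ, θ.spectralProj μ χ x = 0) : x = 0 := by
  simpa using θ.mem_of_forall_spectralProj_mem μ ⊥ (by simp) (x := x) (by simpa using h)


end CStarSystem

end Spectral

/-! ### Isomorphisms determined by their values on spectral subspaces -/

namespace CStarSystem

open MeasureTheory

variable {Z : Type*} [CommGroup Z] [TopologicalSpace Z] [IsTopologicalGroup Z] [CompactSpace Z]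
  {X Y : Type*} [CStarAlgebra X] [CStarAlgebra Y]

/-- The spectral subspaces span a dense subspace. -/
theorem mem_of_spectral_le (θ : CStarSystem Z X) (W : Submodule ℂ X) (hW : IsClosed (W : Set X))
    (h : ∀ χ, θ.spectral χ ≤ W) (x : X) : x ∈ W := by
  let _ : MeasurableSpace Z := borel Z
  have : BorelSpace Z := ⟨rfl⟩
  let μ : Measure Z := Measure.haarMeasure ⊤
  have : IsProbabilityMeasure μ := ⟨Measure.haarMeasure_self⟩
  exact θ.mem_of_forall_spectralProj_mem μ W hW fun χ => h χ (θ.spectralProj_mem μ χ x)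

open scoped CStarAlgebra in
theorem eq_of_eqOn_spectral (θ : CStarSystem Z X) {f g : X →⋆ₐ[ℂ] Y}
    (h : ∀ χ, ∀ x ∈ θ.spectral χ, f x = g x) (x : X) : f x = g x := by
  have hf : Continuous f := map_continuous f
  have hg : Continuous g := map_continuous g
  exact θ.mem_of_spectral_le (LinearMap.eqLocus f.toLinearMap g.toLinearMap)
    (isClosed_eq hf hg) h x

/-- An element of the closed span of closed subspaces `Γ χ` of pairs of elements of the spectral
subspaces of `χ` has its spectral projections in `Γ χ`. -/
theorem spectralProj_mem_of_mem_closure [MeasurableSpace Z] [BorelSpace Z] (μ : Measure Z)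
    [IsProbabilityMeasure μ] [μ.IsMulLeftInvariant] (θ : CStarSystem Z X) (θ' : CStarSystem Z Y)
    (Γ : PontryaginDual Z → Submodule ℂ (X × Y)) (hcl : ∀ χ, IsClosed (Γ χ : Set (X × Y)))
    (hΓ : ∀ χ, ∀ p ∈ Γ χ, p.1 ∈ θ.spectral χ ∧ p.2 ∈ θ'.spectral χ) {p : X × Y}
    (hp : p ∈ closure ((⨆ χ, Γ χ : Submodule ℂ (X × Y)) : Set (X × Y))) (χ : PontryaginDual Z) :
    (θ.spectralProj μ χ p.1, θ'.spectralProj μ χ p.2) ∈ Γ χ := by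
  let Pr : X × Y →L[ℂ] X × Y := (θ.spectralProj μ χ).prodMap (θ'.spectralProj μ χ)
  change Pr p ∈ Γ χ
  -- The pair of projections is the identity on `Γ χ` and zero on every other `Γ ψ`; closedness of
  -- `Γ χ` then carries the inclusion over to the closure.
  have hle : (⨆ χ, Γ χ) ≤ (Γ χ).comap Pr.toLinearMap := by
    refine iSup_le fun ψ q hq => ?_
    obtain ⟨h1, h2⟩ := hΓ ψ q hq
    change (θ.spectralProj μ χ q.1, θ'.spectralProj μ χ q.2) ∈ Γ χ
    by_cases h : χ = ψ
    · subst h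
      rwa [spectralProj_of_mem μ h1, spectralProj_of_mem μ h2]
    · rw [spectralProj_of_mem_ne μ h h1, spectralProj_of_mem_ne μ h h2]
      exact Submodule.zero_mem _
  exact closure_minimal hle ((hcl χ).preimage Pr.continuous) hp

/-- The `Γ χ` are the graded pieces of the graph of the desired isomorphism. The closure `B` of
their sum is a C*-subalgebra of `X × Y`. If `(0, y)` lies in `B`, then each spectral projection of
`y` is paired with `0` in some `Γ χ`, hence vanishes, and so `y = 0`; the other coordinate is
symmetric. Both coordinate projections are thus isometric on `B`, with closed ranges that contain
all spectral subspaces, hence are everything. The isomorphism is the second projection after the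
inverse of the first. -/
theorem exists_starAlgEquiv_of_graph (θ : CStarSystem Z X) (θ' : CStarSystem Z Y)
    (Γ : PontryaginDual Z → Submodule ℂ (X × Y)) (hcl : ∀ χ, IsClosed (Γ χ : Set (X × Y)))
    (hΓ : ∀ χ, ∀ p ∈ Γ χ, p.1 ∈ θ.spectral χ ∧ p.2 ∈ θ'.spectral χ)
    (hone : 1 ∈ Γ 1) (hmul : ∀ χ ψ, ∀ p ∈ Γ χ, ∀ q ∈ Γ ψ, p * q ∈ Γ (χ * ψ))
    (hstar : ∀ χ, ∀ p ∈ Γ χ, star p ∈ Γ χ⁻¹)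
    (hfst : ∀ χ, ∀ x ∈ θ.spectral χ, ∃ y, (x, y) ∈ Γ χ)
    (hsnd : ∀ χ, ∀ y ∈ θ'.spectral χ, ∃ x, (x, y) ∈ Γ χ)
    (hfst' : ∀ χ y, ((0 : X), y) ∈ Γ χ → y = 0) (hsnd' : ∀ χ x, (x, (0 : Y)) ∈ Γ χ → x = 0) :
    ∃ e : X ≃⋆ₐ[ℂ] Y, ∀ χ, ∀ p ∈ Γ χ, e p.1 = p.2 := by
  let _ : MeasurableSpace Z := borel Z
  have : BorelSpace Z := ⟨rfl⟩
  let μ : Measure Z := Measure.haarMeasure ⊤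
  have : IsProbabilityMeasure μ := ⟨Measure.haarMeasure_self⟩
  let D : StarSubalgebra ℂ (X × Y) :=
    { carrier := (⨆ χ, Γ χ : Submodule ℂ (X × Y))
      mul_mem' := fun {a b} ha hb => by
        refine Submodule.iSup_induction Γ (motive := fun a => a * b ∈ ⨆ χ, Γ χ) ha
          (fun χ a ha => ?_) (by simp) fun a a' h h' => by rw [add_mul]; exact add_mem h h'
        refine Submodule.iSup_induction Γ (motive := fun b => a * b ∈ ⨆ χ, Γ χ) hb
          (fun ψ b hb => Submodule.mem_iSup_of_mem _ (hmul χ ψ a ha b hb)) (by simp)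
          fun b b' h h' => by rw [mul_add]; exact add_mem h h'
      add_mem' := fun ha hb => Submodule.add_mem _ ha hb
      algebraMap_mem' := fun c => by
        rw [Algebra.algebraMap_eq_smul_one]
        exact Submodule.smul_mem _ c (Submodule.mem_iSup_of_mem _ hone)
      star_mem' := fun {a} ha => by
        refine Submodule.iSup_induction Γ (motive := fun a => star a ∈ ⨆ χ, Γ χ) ha
          (fun χ a ha => Submodule.mem_iSup_of_mem _ (hstar χ a ha)) (by simp)
          fun a a' h h' => by rw [star_add]; exact add_mem h h' }
  let B := D.topologicalClosure
  have hB : IsClosed (B : Set (X × Y)) := D.isClosed_topologicalClosure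
  have hproj : ∀ p ∈ B, ∀ χ, (θ.spectralProj μ χ p.1, θ'.spectralProj μ χ p.2) ∈ Γ χ :=
    fun p hp χ => θ.spectralProj_mem_of_mem_closure μ θ' Γ hcl hΓ hp χ
  have hΓB : ∀ χ, ∀ p ∈ Γ χ, p ∈ B := fun χ p hp =>
    D.le_topologicalClosure (Submodule.mem_iSup_of_mem χ hp : p ∈ ⨆ χ, Γ χ)
  let f : B →⋆ₐ[ℂ] X := (StarAlgHom.fst ℂ X Y).comp B.subtype
  let g : B →⋆ₐ[ℂ] Y := (StarAlgHom.snd ℂ X Y).comp B.subtype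
  have hf : Function.Injective f := by
    refine (injective_iff_map_eq_zero f).mpr ?_
    rintro ⟨⟨x, y⟩, hp⟩ (rfl : x = 0)
    have hy : y = 0 := θ'.eq_zero_of_forall_spectralProj μ fun χ => hfst' χ _ <| by
      simpa using hproj _ hp χ
    subst hy
    rfl
  have hg : Function.Injective g := by
    refine (injective_iff_map_eq_zero g).mpr ?_
    rintro ⟨⟨x, y⟩, hp⟩ (rfl : y = 0)
    have hx : x = 0 := θ.eq_zero_of_forall_spectralProj μ fun χ => hsnd' χ _ <| by
      simpa using hproj _ hp χ
    subst hx
    rfl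
  have hfs : Function.Surjective f := fun x =>
    θ.mem_of_spectral_le (LinearMap.range f.toLinearMap)
      (NonUnitalStarAlgHom.isometry f hf).isClosedEmbedding.isClosed_range (fun χ x hx => by
        obtain ⟨y, hy⟩ := hfst χ x hx
        exact ⟨⟨_, hΓB χ _ hy⟩, rfl⟩) x
  have hgs : Function.Surjective g := fun y =>
    θ'.mem_of_spectral_le (LinearMap.range g.toLinearMap)
      (NonUnitalStarAlgHom.isometry g hg).isClosedEmbedding.isClosed_range (fun χ y hy => by
        obtain ⟨x, hx⟩ := hsnd χ y hy
        exact ⟨⟨_, hΓB χ _ hx⟩, rfl⟩) y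
  let ef : B ≃⋆ₐ[ℂ] X := StarAlgEquiv.ofBijective f ⟨hf, hfs⟩
  let eg : B ≃⋆ₐ[ℂ] Y := StarAlgEquiv.ofBijective g ⟨hg, hgs⟩
  refine ⟨ef.symm.trans eg, fun χ p hp => ?_⟩
  have h1 : ef.symm p.1 = ⟨p, hΓB χ p hp⟩ := EquivLike.injective ef <| by
    rw [StarAlgEquiv.apply_symm_apply]
    rfl
  rw [StarAlgEquiv.trans_apply, h1]
  rfl

end CStarSystem

/-! ## Unitary multipliers of Morita self-equivalences -/

namespace MoritaSelfEquivalence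

variable {H : Type*} [Group H] [TopologicalSpace H] {A : Type u} [CStarAlgebra A]
  {β : CStarSystem H A}

theorem linner_smul_left (M : MoritaSelfEquivalence β) (c : ℂ) (x y : M) :
    M.linner (c • x) y = c • M.linner x y := by
  have h : c • x = M.left (algebraMap ℂ A c) x := by
    rw [AlgHom.commutes]
    rfl
  rw [h, M.linner_left, Algebra.smul_def]

/-- The inner products of elementary tensors span an ideal containing a unit. -/
theorem exists_unit_linner_tensor (M N : MoritaSelfEquivalence β) :
    ∃ s : Aˣ, (s : A) ∈ Submodule.span ℂ
      {a | ∃ x y x' y', M.linner (M.right (op (N.linner y y')) x) x' = a} := by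
  set K := Submodule.span ℂ {a | ∃ x y x' y', M.linner (M.right (op (N.linner y y')) x) x' = a}
  obtain ⟨c, hc⟩ := N.exists_unit_linner
  obtain ⟨s, hs⟩ := M.exists_unit_linner
  have h1 : ∀ c ∈ Submodule.span ℂ {a | ∃ x y, N.linner x y = a},
      ∀ x x', M.linner (M.right (op c) x) x' ∈ K := by
    intro c hc x x'
    induction hc using Submodule.span_induction with
    | mem c hc =>
      obtain ⟨y, y', rfl⟩ := hc
      exact Submodule.subset_span ⟨x, y, x', y', rfl⟩
    | zero =>
      have h := M.linner_smul_left 0 x x'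
      rw [zero_smul, zero_smul] at h
      simp [h]
    | add c d _ _ hc hd =>
      rw [op_add, map_add, LinearMap.add_apply, M.linner_add]
      exact add_mem hc hd
    | smul z c _ hc =>
      rw [op_smul, map_smul, LinearMap.smul_apply, M.linner_smul_left]
      exact Submodule.smul_mem _ _ hc
  refine ⟨s, Submodule.span_le.mpr ?_ hs⟩
  rintro _ ⟨x, x', rfl⟩
  -- Acting by `c⁻¹` first undoes the unit `c`, so the span contains every inner product of `M`, in
  -- particular the unit `s`.
  have h2 := h1 c hc (M.right (op ((c⁻¹ : Aˣ) : A)) x) x'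
  rwa [← Module.End.mul_apply, ← map_mul, ← op_mul, Units.inv_mul, op_one, map_one] at h2

theorem mul_eq_of_mem_span {s : Set A} {a b : A} (h : ∀ c ∈ s, a * c = b * c) {c : A}
    (hc : c ∈ Submodule.span ℂ s) : a * c = b * c := by
  induction hc using Submodule.span_induction with
  | mem c hc => exact h c hc
  | zero => simp
  | add c d _ _ hc hd => rw [mul_add, mul_add, hc, hd]
  | smul z c _ hc => rw [mul_smul_comm, mul_smul_comm, hc]

/-- Two full families in `P` with the same inner products, that are compatible with the left action
of `A` and with the action of `H`, differ by an invariant central unitary. -/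
theorem exists_centralUnitary_of_family (P : MoritaSelfEquivalence β) {I : Type*} (p p' : I → P)
    (hl : ∀ i j, P.linner (p' i) (p' j) = P.linner (p i) (p j))
    (hr : ∀ i j, P.rinner (p' i) (p' j) = P.rinner (p i) (p j))
    (hleft : ∀ a i, ∃ j, p j = P.left a (p i) ∧ p' j = P.left a (p' i))
    (hact : ∀ g i, ∃ j, p j = P.act g (p i) ∧ p' j = P.act g (p' i))
    (s : Aˣ) (hs : (s : A) ∈ Submodule.span ℂ {a | ∃ i j, P.linner (p i) (p j) = a}) :
    ∃ v : β.centralUnitary, ∀ i, p' i = P.left ((v : unitary A) : A) (p i) := by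
  have key : ∀ c ∈ Submodule.span ℂ {a | ∃ i j, P.linner (p i) (p j) = a},
      ∃ w : A, ∀ i, P.left w (p i) = P.left c (p' i) := by
    intro c hc
    induction hc using Submodule.span_induction with
    | mem c hc =>
      obtain ⟨i, j, rfl⟩ := hc
      -- Compatibility of the inner products gives `⟨p' i, p j⟩ p k = p' i ⟨p j, p k⟩ = p' i ⟨p' j,
      -- p' k⟩ = ⟨p' i, p' j⟩ p' k`, and the last coefficient equals `⟨p i, p j⟩`.
      exact ⟨P.linner (p' i) (p j), fun k => by
        rw [← hl, P.left_linner, P.left_linner, hr]⟩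
    | zero => exact ⟨0, fun i => by simp⟩
    | add c d _ _ hc hd =>
      obtain ⟨v, hv⟩ := hc
      obtain ⟨v', hv'⟩ := hd
      exact ⟨v + v', fun x => by simp [hv, hv']⟩
    | smul z c _ hc =>
      obtain ⟨v, hv⟩ := hc
      exact ⟨z • v, fun x => by simp [hv]⟩
  obtain ⟨w, hw⟩ := key s hs
  obtain ⟨v, hv⟩ : ∃ v : A, ∀ i, p' i = P.left v (p i) := by
    refine ⟨((s⁻¹ : Aˣ) : A) * w, fun i => ?_⟩
    rw [map_mul, Module.End.mul_apply, hw, ← Module.End.mul_apply, ← map_mul, Units.inv_mul,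
      map_one, Module.End.one_apply]
  have hcancel : ∀ a b : A, (∀ i j, a * P.linner (p i) (p j) = b * P.linner (p i) (p j)) →
      a = b := fun a b h => s.isUnit.mul_right_cancel <| mul_eq_of_mem_span
        (by rintro _ ⟨i, j, rfl⟩; exact h i j) hs
  have hfaith : ∀ a b : A, (∀ i, P.left a (p i) = P.left b (p i)) → a = b := fun a b h =>
    hcancel a b fun i j => by rw [← P.linner_left, ← P.linner_left, h]
  -- Both families are compatible with the left action, so `v` commutes with `a` on every `p i`; the
  -- left action is faithful on these vectors because their inner products span a unit.
  have hcent : ∀ a, v * a = a * v := fun a => hfaith _ _ fun i => by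
    obtain ⟨j, h, h'⟩ := hleft a i
    rw [map_mul, map_mul, Module.End.mul_apply, Module.End.mul_apply, ← h, ← hv, ← hv, h']
  have hcent' : ∀ a, star v * a = a * star v := fun a => by
    simpa using (congrArg star (hcent (star a))).symm
  have hvv : v * star v = 1 := hcancel _ _ fun i j => by
    have h := hl i j
    rw [hv i, hv j, P.linner_left, ← P.star_linner, P.linner_left, star_mul, P.star_linner] at h
    rw [one_mul, mul_assoc, hcent', h]
  refine ⟨⟨⟨v, Unitary.mem_iff.mpr ⟨by rw [hcent', hvv], hvv⟩⟩, hcent, fun g => ?_⟩, hv⟩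
  refine hfaith _ _ fun i => ?_
  -- The inverse is taken so that `p i` itself has the form `P.act g (p j)`.
  obtain ⟨j, h, h'⟩ := hact g⁻¹ i
  have e : p i = P.act g (p j) := by rw [h, P.act_act_inv]
  change P.left (β.act g v) (p i) = P.left v (p i)
  rw [← hv i, e, ← P.act_left, ← hv j, h', P.act_act_inv]

theorem Iso.norm_map {M N : MoritaSelfEquivalence β} (e : Iso M N) (x : M) : ‖e x‖ = ‖x‖ := by
  have h : ‖e x‖ ^ 2 = ‖x‖ ^ 2 := by rw [← norm_linner, ← norm_linner, e.map_linner]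
  exact (sq_eq_sq₀ (norm_nonneg _) (norm_nonneg _)).mp h

end MoritaSelfEquivalence

/-! ## Structures with given isotypic components -/

namespace StructureOn

variable {Z Gh G : Type*} [CommGroup Z] [TopologicalSpace Z] [IsTopologicalGroup Z] [CompactSpace Z]
  [Group Gh] [TopologicalSpace Gh] [CompactSpace Gh] [T2Space Gh]
  [Group G] [TopologicalSpace G] {A : Type u} [CStarAlgebra A]
  {E : CentralExtension Z Gh G} {α : CStarSystem G A}
  {M : PontryaginDual Z → MoritaSelfEquivalence (α.pullback E.q)}
  {e₀ : (MoritaSelfEquivalence.unit (α.pullback E.q)).Iso (M 1)}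

/-- The embedding of `M(χ)` into `Â` as the isotypic component of `χ`. -/
noncomputable def emb (T : StructureOn M e₀) (χ : PontryaginDual Z) : M χ →ₗ[ℂ] T.carrier where
  toFun x := GHatStructure.val (T.comp χ x)
  map_add' x y := congrArg GHatStructure.val (map_add (T.comp χ).toEquiv x y)
  map_smul' c x := congrArg GHatStructure.val (map_smul (T.comp χ).toEquiv c x)

variable (T T' : StructureOn M e₀)

theorem emb_mem {χ : PontryaginDual Z} (x : M χ) : T.emb χ x ∈ T.isotypic χ :=
  GHatStructure.val_mem _

theorem emb_injective (χ : PontryaginDual Z) : Function.Injective (T.emb χ) := fun _ _ h =>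
  (T.comp χ).toEquiv.injective (Subtype.ext h)

theorem exists_emb_eq {χ : PontryaginDual Z} {u : T.carrier} (hu : u ∈ T.isotypic χ) :
    ∃ x, T.emb χ x = u := by
  obtain ⟨x, hx⟩ := (T.comp χ).toEquiv.surjective ⟨u, hu⟩
  exact ⟨x, congrArg GHatStructure.val hx⟩

theorem norm_emb {χ : PontryaginDual Z} (x : M χ) : ‖T.emb χ x‖ = ‖x‖ :=
  (T.comp χ).norm_map x

theorem emb_left {χ : PontryaginDual Z} (a : A) (x : M χ) :
    T.emb χ ((M χ).left a x) = T.incl a * T.emb χ x :=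
  congrArg GHatStructure.val ((T.comp χ).map_left a x)

theorem emb_right {χ : PontryaginDual Z} (a : A) (x : M χ) :
    T.emb χ ((M χ).right (op a) x) = T.emb χ x * T.incl a :=
  congrArg GHatStructure.val ((T.comp χ).map_right (op a) x)

theorem emb_act {χ : PontryaginDual Z} (g : Gh) (x : M χ) :
    T.emb χ ((M χ).act g x) = T.system.act g (T.emb χ x) :=
  congrArg GHatStructure.val ((T.comp χ).map_act g x)

theorem incl_linner {χ : PontryaginDual Z} (x y : M χ) :
    T.incl ((M χ).linner x y) = T.emb χ x * star (T.emb χ y) := by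
  rw [← (T.comp χ).map_linner, GHatStructure.incl_linner]
  rfl

theorem incl_rinner {χ : PontryaginDual Z} (x y : M χ) :
    T.incl ((M χ).rinner x y) = star (T.emb χ x) * T.emb χ y := by
  rw [← (T.comp χ).map_rinner, GHatStructure.incl_rinner]
  rfl

theorem emb_mul {χ χ' : PontryaginDual Z} (x : M χ) (y : M χ') :
    T.emb (χ * χ') (T.mul χ χ' x y) = T.emb χ x * T.emb χ' y :=
  congrArg GHatStructure.val ((T.comp (χ * χ')).toEquiv.apply_symm_apply _)

theorem emb_one (a : A) : T.emb 1 (e₀ a) = T.incl a :=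
  T.comp_one a

/-- By fullness the products `x y*` with `x`, `y` in the component of `χ` span an invertible element
of `A`, so right multiplication by one component already separates the elements of `Â`. -/
theorem eq_zero_of_mul_emb {χ : PontryaginDual Z} {u : T.carrier}
    (h : ∀ x, u * T.emb χ x = 0) : u = 0 := by
  obtain ⟨s, hs⟩ := (M χ).exists_unit_linner
  have h1 : ∀ c ∈ Submodule.span ℂ {a | ∃ x y, (M χ).linner x y = a}, u * T.incl c = 0 := by
    intro c hc
    induction hc using Submodule.span_induction with
    | mem c hc =>
      obtain ⟨x, y, rfl⟩ := hc
      rw [incl_linner, ← mul_assoc, h, zero_mul]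
    | zero => simp
    | add c d _ _ hc hd => rw [map_add, mul_add, hc, hd, add_zero]
    | smul z c _ hc => rw [map_smul, mul_smul_comm, hc, smul_zero]
  have h2 := congrArg (· * T.incl ((s⁻¹ : Aˣ) : A)) (h1 s hs)
  simpa [mul_assoc, ← map_mul] using h2

theorem eq_of_mul_emb {χ : PontryaginDual Z} {u v : T.carrier}
    (h : ∀ x, u * T.emb χ x = v * T.emb χ x) : u = v :=
  sub_eq_zero.mp <| T.eq_zero_of_mul_emb (χ := χ) fun x => by rw [sub_mul, h, sub_self]

theorem eq_of_left_mul {χ χ' : PontryaginDual Z} {a b : A}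
    (h : ∀ x y, (M (χ * χ')).left a (T.mul χ χ' x y) = (M (χ * χ')).left b (T.mul χ χ' x y)) :
    a = b := by
  refine T.incl_injective (T.eq_of_mul_emb (χ := χ) fun x => T.eq_of_mul_emb (χ := χ') fun y => ?_)
  rw [mul_assoc, mul_assoc, ← emb_mul, ← emb_left, ← emb_left, h]

/-- Replaces casts between `M χ` and `M χ'` for characters such as `1 * χ` and `χ`: an
identification that holds inside one structure holds inside every other one on the same `M`. -/
theorem emb_eq_of_emb_eq {χ χ' : PontryaginDual Z} (h : χ = χ') {x : M χ} {x' : M χ'}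
    (hx : T.emb χ x = T.emb χ' x') : T'.emb χ x = T'.emb χ' x' := by
  subst h
  rw [T.emb_injective _ hx]

theorem emb_mul_incl {χ : PontryaginDual Z} (w : (α.pullback E.q).centralUnitary) (x : M χ) :
    T.emb χ x * T.incl ((w : unitary A) : A) =
      T.incl (((M χ).frohlich w : unitary A) : A) * T.emb χ x := by
  rw [← emb_right, ← emb_left, (M χ).left_frohlich]

/-- The right-hand side does not depend on `T`. With `rinner_mul`, this is why the products of two
structures have the same inner products. -/
theorem linner_mul {χ χ' : PontryaginDual Z} (x x' : M χ) (y y' : M χ') :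
    (M (χ * χ')).linner (T.mul χ χ' x y) (T.mul χ χ' x' y') =
      (M χ).linner ((M χ).right (op ((M χ').linner y y')) x) x' := T.incl_injective <| by
  rw [incl_linner, emb_mul, emb_mul, incl_linner, emb_right, incl_linner, star_mul]
  simp only [mul_assoc]

theorem rinner_mul {χ χ' : PontryaginDual Z} (x x' : M χ) (y y' : M χ') :
    (M (χ * χ')).rinner (T.mul χ χ' x y) (T.mul χ χ' x' y') =
      (M χ').rinner y ((M χ').left ((M χ).rinner x x') y') := T.incl_injective <| by
  rw [incl_rinner, emb_mul, emb_mul, incl_rinner, emb_left, incl_rinner, star_mul]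
  simp only [mul_assoc]

theorem mul_left {χ χ' : PontryaginDual Z} (a : A) (x : M χ) (y : M χ') :
    T.mul χ χ' ((M χ).left a x) y = (M (χ * χ')).left a (T.mul χ χ' x y) := by
  refine T.emb_injective _ ?_
  rw [emb_mul, emb_left, emb_left, emb_mul, mul_assoc]

theorem mul_act {χ χ' : PontryaginDual Z} (g : Gh) (x : M χ) (y : M χ') :
    T.mul χ χ' ((M χ).act g x) ((M χ').act g y) = (M (χ * χ')).act g (T.mul χ χ' x y) := by
  refine T.emb_injective _ ?_
  rw [emb_mul, emb_act, emb_act, emb_act, emb_mul, map_mul]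

/-- For each pair of characters, the products in `T` and in `T'` are two families indexed by `M χ ×
M χ'` to which `exists_centralUnitary_of_family` applies. -/
theorem exists_differBy : ∃ ω, T.DifferBy T' ω := by
  have h : ∀ p : PontryaginDual Z × PontryaginDual Z, ∃ v : (α.pullback E.q).centralUnitary,
      ∀ q : M p.1 × M p.2, T'.mul p.1 p.2 q.1 q.2 =
        (M (p.1 * p.2)).left ((v : unitary A) : A) (T.mul p.1 p.2 q.1 q.2) := by
    intro p
    obtain ⟨s, hs⟩ := (M p.1).exists_unit_linner_tensor (M p.2)
    refine (M (p.1 * p.2)).exists_centralUnitary_of_family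
      (fun q : M p.1 × M p.2 => T.mul p.1 p.2 q.1 q.2) (fun q => T'.mul p.1 p.2 q.1 q.2)
      (fun _ _ => ?_) (fun _ _ => ?_)
      (fun a q => ⟨((M p.1).left a q.1, q.2), T.mul_left _ _ _, T'.mul_left _ _ _⟩)
      (fun g q => ⟨((M p.1).act g q.1, (M p.2).act g q.2), T.mul_act _ _ _, T'.mul_act _ _ _⟩)
      s (Submodule.span_mono ?_ hs)
    · rw [linner_mul, linner_mul]
    · rw [rinner_mul, rinner_mul]
    · rintro _ ⟨x, y, x', y', rfl⟩
      exact ⟨(x, y), (x', y'), T.linner_mul x x' y y'⟩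
  choose v hv using h
  exact ⟨v, fun χ χ' x y => hv (χ, χ') (x, y)⟩

variable {T T'} {ω : PontryaginDual Z × PontryaginDual Z → (α.pullback E.q).centralUnitary}

theorem DifferBy.unique {ω' : PontryaginDual Z × PontryaginDual Z → (α.pullback E.q).centralUnitary}
    (h : T.DifferBy T' ω) (h' : T.DifferBy T' ω') : ω' = ω := by
  ext1 ⟨χ, χ'⟩
  apply Subtype.ext; apply Subtype.ext
  exact T.eq_of_left_mul fun x y => by rw [← h, ← h']

theorem DifferBy.emb_mul_emb (h : T.DifferBy T' ω) {χ χ' : PontryaginDual Z} (x : M χ) (y : M χ') :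
    T'.emb χ x * T'.emb χ' y = T'.incl ((ω (χ, χ') : unitary A) : A) *
      T'.emb (χ * χ') (T.mul χ χ' x y) := by
  rw [← emb_mul, h, emb_left]

/-- Both structures identify `M 1` with `A` through the same `e₀`, so the element `e₀ 1` acts as the
identity in both. -/
theorem DifferBy.one_left (h : T.DifferBy T' ω) (χ : PontryaginDual Z) : ω (1, χ) = 1 := by
  apply Subtype.ext; apply Subtype.ext
  refine T'.incl_injective (T'.eq_of_mul_emb (χ := χ) fun x => ?_)
  have h1 : T'.emb (1 * χ) (T.mul 1 χ (e₀ (1 : A)) x) = T'.emb χ x :=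
    T.emb_eq_of_emb_eq T' (one_mul χ) (by rw [emb_mul, emb_one, map_one, one_mul])
  have h2 := h.emb_mul_emb (e₀ (1 : A)) x
  rw [emb_one, h1] at h2
  rw [← h2]
  rfl

theorem DifferBy.one_right (h : T.DifferBy T' ω) (χ : PontryaginDual Z) : ω (χ, 1) = 1 := by
  apply Subtype.ext; apply Subtype.ext
  refine T'.incl_injective (T'.eq_of_mul_emb (χ := χ) fun x => ?_)
  have h1 : T'.emb (χ * 1) (T.mul χ 1 x (e₀ (1 : A))) = T'.emb χ x :=
    T.emb_eq_of_emb_eq T' (mul_one χ) (by rw [emb_mul, emb_one, map_one, mul_one])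
  have h2 := h.emb_mul_emb x (e₀ (1 : A))
  rw [emb_one, h1, map_one, mul_one] at h2
  rw [← h2]
  change _ = T'.incl 1 * _
  rw [map_one, one_mul]

/-- Associativity in `T'`, expressed through the products of `T`: bracketing to the left gives the
left side, while bracketing to the right leaves `ω (χ', χ'')` behind `x`, and moving it to the front
applies the automorphism of `M χ`. -/
theorem DifferBy.mul_mul (h : T.DifferBy T' ω) (χ χ' χ'' : PontryaginDual Z) :
    ω (χ * χ', χ'') * ω (χ, χ') = (M χ).frohlich (ω (χ', χ'')) * ω (χ, χ' * χ'') := by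
  have key : ∀ x y z, T'.incl ((ω (χ * χ', χ'') * ω (χ, χ') : unitary A) : A) *
      T'.emb _ (T.mul _ χ'' (T.mul χ χ' x y) z) =
      T'.incl (((M χ).frohlich (ω (χ', χ'')) * ω (χ, χ' * χ'') : unitary A) : A) *
      T'.emb _ (T.mul _ χ'' (T.mul χ χ' x y) z) := by
    intro x y z
    have h1 : T'.emb (χ * χ' * χ'') (T.mul _ χ'' (T.mul χ χ' x y) z) =
        T'.emb (χ * (χ' * χ'')) (T.mul χ _ x (T.mul χ' χ'' y z)) :=
      T.emb_eq_of_emb_eq T' (mul_assoc _ _ _) (by simp only [emb_mul, mul_assoc])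
    calc _ = T'.incl ((ω (χ, χ') : unitary A) : A) * (T'.emb _ (T.mul χ χ' x y) * T'.emb _ z) := by
          rw [h.emb_mul_emb, ← mul_assoc, ← map_mul, (ω (χ, χ')).2.1]
          rfl
      _ = T'.emb χ x * T'.emb χ' y * T'.emb χ'' z := by rw [h.emb_mul_emb x y, mul_assoc]
      _ = T'.incl (((M χ).frohlich (ω (χ', χ'')) : unitary A) : A) *
          (T'.emb χ x * T'.emb _ (T.mul χ' χ'' y z)) := by
          rw [mul_assoc, h.emb_mul_emb y z, ← mul_assoc, emb_mul_incl, mul_assoc]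
      _ = _ := by
          rw [h.emb_mul_emb, ← h1, ← mul_assoc, ← map_mul]
          rfl
  apply Subtype.ext; apply Subtype.ext
  -- The three factors are cancelled inside `T`, while `key` is an identity inside `T'`; both are
  -- read as one identity in `M (χ * χ' * χ'')`.
  refine T.incl_injective (T.eq_of_mul_emb (χ := χ) fun x => T.eq_of_mul_emb (χ := χ') fun y =>
    T.eq_of_mul_emb (χ := χ'') fun z => ?_)
  rw [mul_assoc, mul_assoc, mul_assoc, mul_assoc, ← mul_assoc (T.emb χ x), ← emb_mul, ← emb_mul,
    ← emb_left, ← emb_left]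
  exact congrArg _ (T'.emb_injective _ (by rw [emb_left, emb_left]; exact key x y z))

end StructureOn

/-! ### Classes of structures and coboundaries -/

section Classification

variable {Z Gh G : Type*} [CommGroup Z] [TopologicalSpace Z] [IsTopologicalGroup Z] [CompactSpace Z]
  [Group Gh] [TopologicalSpace Gh] [CompactSpace Gh] [T2Space Gh]
  [Group G] [TopologicalSpace G] {A : Type u} [CStarAlgebra A]
  {E : CentralExtension Z Gh G} {α : CStarSystem G A}

/-- The isotypic component of the trivial character is `A`. -/
noncomputable def GHatStructure.unitIso (S : GHatStructure E α) :
    (MoritaSelfEquivalence.unit (α.pullback E.q)).Iso (S.isotypicMorita 1) where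
  toEquiv := LinearEquiv.ofBijective
    ({ toFun := fun a : A => (⟨S.incl a, GHatStructure.incl_mem_isotypic a⟩ : S.isotypic 1)
       map_add' := fun a b => Subtype.ext (map_add _ a b)
       map_smul' := fun c a => Subtype.ext (map_smul _ c a) } : A →ₗ[ℂ] S.isotypic 1)
    ⟨fun a b h => S.incl_injective (congrArg Subtype.val h), fun x => by
      obtain ⟨a, ha⟩ := GHatStructure.mem_range_incl_of_isotypic x.2
      exact ⟨a, Subtype.ext ha⟩⟩
  map_left a := fun x : A => Subtype.ext (map_mul S.incl a x)
  map_right a := fun x : A => Subtype.ext (map_mul S.incl x a.unop)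
  map_linner := fun x y : A => S.incl_injective <| by
    rw [GHatStructure.incl_linner]
    exact ((map_mul S.incl x (star y)).trans (congrArg _ (map_star S.incl y))).symm
  map_rinner := fun x y : A => S.incl_injective <| by
    rw [GHatStructure.incl_rinner]
    exact ((map_mul S.incl (star x) y).trans (congrArg (· * S.incl y) (map_star S.incl x))).symm
  map_act g x := Subtype.ext (S.act_incl g x).symm

variable {p : PicHom (PontryaginDual Z) (α.pullback E.q)}
  {M : PontryaginDual Z → MoritaSelfEquivalence (α.pullback E.q)}
  (e₀ : (MoritaSelfEquivalence.unit (α.pullback E.q)).Iso (M 1))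

/-- Equality of classes in the Picard group supplies an isomorphism for each character. At the
trivial character an arbitrary choice need not be the identity of `A`, so it is replaced by the one
that `e₀` dictates. -/
theorem GHatStructure.exists_structureOn (S : GHatStructure E α) (hS : S.picard = p)
    (hM : ∀ χ, (M χ).cls = p.toFun χ) : ∃ T : StructureOn M e₀, T.toGHatStructure = S := by
  classical
  have h : ∀ χ, Nonempty ((M χ).Iso (S.isotypicMorita χ)) := fun χ => by
    have h1 : (M χ).cls = (S.isotypicMorita χ).cls := by
      rw [hM, ← hS]
      rfl
    exact Quotient.exact h1
  refine ⟨⟨S, Function.update (fun χ => (h χ).some) 1 (e₀.symm.trans S.unitIso), fun a => ?_⟩, rfl⟩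
  rw [Function.update_self]
  have h1 : (e₀.symm.trans S.unitIso) (e₀ a) = S.unitIso a :=
    congrArg S.unitIso (e₀.toEquiv.symm_apply_apply a)
  rw [h1]
  rfl

variable {e₀}

theorem StructureOn.picard_eq (T : StructureOn M e₀) (hM : ∀ χ, (M χ).cls = p.toFun χ) :
    T.picard = p := by
  have h : T.picard.toFun = p.toFun := by
    ext1 χ
    rw [← hM]
    exact (Quotient.sound ⟨T.comp χ⟩ : (M χ).cls = (T.isotypicMorita χ).cls).symm
  generalize T.picard = p' at h
  cases p'
  cases p
  congr

theorem mem_extOver_iff (hM : ∀ χ, (M χ).cls = p.toFun χ) (c : Ext E α) :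
    c ∈ ExtOver p ↔ ∃ T : StructureOn M e₀, T.cls = c := by
  constructor
  · rintro ⟨S, rfl, hS⟩
    obtain ⟨T, rfl⟩ := S.exists_structureOn e₀ hS hM
    exact ⟨T, rfl⟩
  · rintro ⟨T, rfl⟩
    exact ⟨T.toGHatStructure, rfl, T.picard_eq hM⟩

namespace StructureOn

variable {T T' : StructureOn M e₀}
  {ω : PontryaginDual Z × PontryaginDual Z → (α.pullback E.q).centralUnitary}

/-- An equivalence is on the isotypic components the multiplication by unitaries whose coboundary
relates the multiplication maps. -/
theorem DifferBy.exists_of_equivalence (h : T.DifferBy T' ω)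
    (e : GHatStructure.Equivalence T.toGHatStructure T'.toGHatStructure) :
    ∃ v : PontryaginDual Z → (α.pullback E.q).centralUnitary,
      ∀ χ χ', v (χ * χ') = v χ * (M χ).frohlich (v χ') * ω (χ, χ') := by
  have he : ∀ χ, ∃ v : (α.pullback E.q).centralUnitary, ∀ x : M χ,
      e.toEquiv (T.emb χ x) = T'.incl ((v : unitary A) : A) * T'.emb χ x := by
    intro χ
    have h1 : ∀ x : M χ, ∃ y : M χ, T'.emb χ y = e.toEquiv (T.emb χ x) := fun x =>
      T'.exists_emb_eq fun z => by rw [← e.map_act, T.emb_mem x z, map_smul]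
    choose f hf using h1
    obtain ⟨s, hs⟩ := (M χ).exists_unit_linner
    -- Here `f` is the equivalence read as a map of `M χ` to itself. It preserves both inner
    -- products because these take values in `A`, which `e` fixes.
    obtain ⟨v, hv⟩ := (M χ).exists_centralUnitary_of_family id f
      (fun x y => T'.incl_injective <| by
        rw [incl_linner, hf, hf, ← map_star, ← map_mul, ← incl_linner, e.map_incl]
        rfl)
      (fun x y => T'.incl_injective <| by
        rw [incl_rinner, hf, hf, ← map_star, ← map_mul, ← incl_rinner, e.map_incl]
        rfl)
      (fun a x => ⟨(M χ).left a x, rfl, T'.emb_injective χ <| by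
        rw [hf, emb_left, emb_left, map_mul, e.map_incl, hf]⟩)
      (fun g x => ⟨(M χ).act g x, rfl, T'.emb_injective χ <| by
        rw [hf, emb_act, emb_act, e.map_act, hf]⟩) s hs
    exact ⟨v, fun x => by rw [← hf, hv, emb_left]; rfl⟩
  choose v hv using he
  refine ⟨v, fun χ χ' => ?_⟩
  apply Subtype.ext; apply Subtype.ext
  -- The image under `e` of a product is computed once as the image of an element of `M (χ * χ')`
  -- and once factor by factor.
  refine T.eq_of_left_mul (χ := χ) (χ' := χ') fun x y => T'.emb_injective _ ?_
  rw [emb_left, ← hv, emb_mul, map_mul, hv, hv, mul_assoc, ← mul_assoc (T'.emb χ x), emb_mul_incl,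
    mul_assoc, h.emb_mul_emb, emb_left]
  simp only [← mul_assoc, ← map_mul]
  rfl

/-! ### From a trivialising cochain to an equivalence -/

section Twist

variable {v : PontryaginDual Z → (α.pullback E.q).centralUnitary}

/-- The embedding of `M(χ)` into `Â`, composed with the multiplication by a unitary. -/
noncomputable def twist (T : StructureOn M e₀)
    (v : PontryaginDual Z → (α.pullback E.q).centralUnitary) (χ : PontryaginDual Z) :
    M χ →ₗ[ℂ] T.carrier :=
  T.emb χ ∘ₗ (M χ).left ((v χ : unitary A) : A)

theorem twist_apply (χ : PontryaginDual Z) (x : M χ) :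
    T.twist v χ x = T.incl ((v χ : unitary A) : A) * T.emb χ x :=
  T.emb_left _ _

theorem twist_mem {χ : PontryaginDual Z} (x : M χ) : T.twist v χ x ∈ T.isotypic χ :=
  T.emb_mem _

theorem twist_left_star (χ : PontryaginDual Z) (x : M χ) :
    T.twist v χ ((M χ).left (star ((v χ : unitary A) : A)) x) = T.emb χ x := by
  rw [twist_apply, emb_left, ← mul_assoc, ← map_mul, Unitary.mul_star_self_of_mem (v χ).1.2, map_one,
    one_mul]

theorem norm_twist (χ : PontryaginDual Z) (x : M χ) : ‖T.twist v χ x‖ = ‖x‖ := by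
  rw [twist_apply, CStarRing.norm_mem_unitary_mul _ (Unitary.map_mem T.incl (v χ).1.2), norm_emb]

theorem twist_injective (χ : PontryaginDual Z) : Function.Injective (T.twist v χ) :=
  (injective_iff_map_eq_zero _).mpr fun x hx => by
    rw [← norm_eq_zero, ← T.norm_twist (v := v), hx, norm_zero]

theorem twist_act (g : Gh) {χ : PontryaginDual Z} (x : M χ) :
    T.twist v χ ((M χ).act g x) = T.system.act g (T.twist v χ x) := by
  rw [twist_apply, twist_apply, map_mul, emb_act, T.act_incl]
  congr 2
  exact ((v χ).2.2 g).symm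

theorem eq_of_mul_twist {χ : PontryaginDual Z} {a b : T.carrier}
    (h : ∀ x, a * T.twist v χ x = b * T.twist v χ x) : a = b :=
  T.eq_of_mul_emb (χ := χ) fun x => by rw [← T.twist_left_star (v := v), h]

theorem star_twist_mul_twist {χ : PontryaginDual Z} (x y : M χ) :
    star (T.twist v χ x) * T.twist v χ y = T.incl ((M χ).rinner x y) := by
  rw [twist_apply, twist_apply, star_mul, ← map_star T.incl, mul_assoc,
    ← mul_assoc (T.incl _), ← map_mul, Unitary.star_mul_self_of_mem (v χ).1.2, map_one,
    one_mul, incl_rinner]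

/-- The condition on `v` is exactly what makes the twisted embeddings into `T'` multiplicative for
the product of `T`. -/
theorem DifferBy.twist_mul_twist (h : T.DifferBy T' ω)
    (hv : ∀ χ χ', v (χ * χ') = v χ * (M χ).frohlich (v χ') * ω (χ, χ')) {χ χ' : PontryaginDual Z}
    (x : M χ) (y : M χ') :
    T'.twist v χ x * T'.twist v χ' y = T'.twist v (χ * χ') (T.mul χ χ' x y) := by
  rw [twist_apply, twist_apply, twist_apply, mul_assoc, ← mul_assoc (T'.emb χ x), emb_mul_incl,
    mul_assoc, h.emb_mul_emb, hv]
  simp only [← mul_assoc, ← map_mul]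
  rfl

theorem twist_one (hv : v 1 = 1) (a : A) : T.twist v 1 (e₀ a) = T.incl a := by
  rw [twist_apply, hv, emb_one]
  exact (congrArg (· * T.incl a) (map_one T.incl)).trans (one_mul _)

theorem twist_eq_of_emb_eq {χ χ' : PontryaginDual Z} (h : χ = χ') {x : M χ} {x' : M χ'}
    (hx : T.emb χ x = T.emb χ' x') : T'.twist v χ x = T'.twist v χ' x' := by
  subst h
  rw [T.emb_injective _ hx]

/-- Adjoints are determined by products: multiplied on the right by a twisted `z`, both sides become
the inner product of `x` and `z` in `A`, where the normalisation of `v` makes the twist trivial.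
Cancelling `z` gives the claim. -/
theorem DifferBy.star_twist (h : T.DifferBy T' ω)
    (hv : ∀ χ χ', v (χ * χ') = v χ * (M χ).frohlich (v χ') * ω (χ, χ')) (hv1 : v 1 = 1)
    {χ : PontryaginDual Z} {x : M χ} {y : M χ⁻¹} (hxy : T.emb χ⁻¹ y = star (T.emb χ x)) :
    T'.twist v χ⁻¹ y = star (T'.twist v χ x) := by
  refine T'.eq_of_mul_twist (v := v) (χ := χ) fun z => ?_
  rw [star_twist_mul_twist, h.twist_mul_twist hv, ← T'.twist_one hv1]
  refine twist_eq_of_emb_eq (T := T) (inv_mul_cancel χ) ?_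
  rw [emb_mul, hxy, ← incl_rinner, emb_one]

/-- The graph consists of the pairs of `T.emb χ x` and `T'.twist v χ x`. Its pieces are closed,
being isometric images of the complete spaces `M χ`. Equivariance is checked on isotypic components
only, since these are total. -/
theorem DifferBy.nonempty_equivalence (h : T.DifferBy T' ω)
    (hv : ∀ χ χ', v (χ * χ') = v χ * (M χ).frohlich (v χ') * ω (χ, χ')) (hv1 : v 1 = 1) :
    Nonempty (GHatStructure.Equivalence T.toGHatStructure T'.toGHatStructure) := by
  let θ : CStarSystem Z T.carrier := T.system.pullback E.ι
  let θ' : CStarSystem Z T'.carrier := T'.system.pullback E.ι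
  let Γ : PontryaginDual Z → Submodule ℂ (T.carrier × T'.carrier) := fun χ =>
    LinearMap.range ((T.emb χ).prod (T'.twist v χ))
  have hmem : ∀ χ x, (T.emb χ x, T'.twist v χ x) ∈ Γ χ := fun χ x => ⟨x, rfl⟩
  obtain ⟨e, he⟩ := θ.exists_starAlgEquiv_of_graph θ' Γ
    (fun χ => by
      let L : M χ →ₗᵢ[ℂ] T.carrier × T'.carrier := ⟨(T.emb χ).prod (T'.twist v χ), fun x => by
        change max ‖T.emb χ x‖ ‖T'.twist v χ x‖ = ‖x‖
        rw [norm_emb, norm_twist, max_self]⟩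
      exact L.isometry.isClosedEmbedding.isClosed_range)
    (by
      rintro χ _ ⟨x, rfl⟩
      exact ⟨T.emb_mem x, T'.twist_mem x⟩)
    ⟨e₀ (1 : A), Prod.ext ((T.emb_one 1).trans (map_one _)) ((T'.twist_one hv1 1).trans (map_one _))⟩
    (by
      rintro χ ψ _ ⟨x, rfl⟩ _ ⟨y, rfl⟩
      exact ⟨T.mul χ ψ x y, Prod.ext (T.emb_mul x y) (h.twist_mul_twist hv x y).symm⟩)
    (by
      rintro χ _ ⟨x, rfl⟩
      obtain ⟨y, hy⟩ := T.exists_emb_eq (GHatStructure.star_mem_isotypic (T.emb_mem x))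
      exact ⟨y, Prod.ext hy (h.star_twist hv hv1 hy)⟩)
    (fun χ u hu => by
      obtain ⟨x, rfl⟩ := T.exists_emb_eq hu
      exact ⟨_, hmem χ x⟩)
    (fun χ u hu => by
      obtain ⟨x, rfl⟩ := T'.exists_emb_eq hu
      rw [← T'.twist_left_star (v := v)]
      exact ⟨_, hmem χ _⟩)
    (by
      rintro χ y ⟨x, hx⟩
      obtain ⟨hx1, rfl⟩ := Prod.mk.inj hx
      rw [(map_eq_zero_iff _ (T.emb_injective χ)).mp hx1, map_zero])
    (by
      rintro χ y ⟨x, hx⟩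
      obtain ⟨rfl, hx1⟩ := Prod.mk.inj hx
      rw [(map_eq_zero_iff _ (T'.twist_injective χ)).mp hx1, map_zero])
  have he' : ∀ χ (x : M χ), e (T.emb χ x) = T'.twist v χ x := fun χ x => he χ _ (hmem χ x)
  refine ⟨⟨e, fun g u => ?_, fun a => ?_⟩⟩
  · refine θ.eq_of_eqOn_spectral
      (f := (e : T.carrier →⋆ₐ[ℂ] T'.carrier).comp (T.system.act g : T.carrier →⋆ₐ[ℂ] T.carrier))
      (g := (T'.system.act g : T'.carrier →⋆ₐ[ℂ] T'.carrier).comp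
        (e : T.carrier →⋆ₐ[ℂ] T'.carrier)) (fun χ u hu => ?_) u
    obtain ⟨x, rfl⟩ := T.exists_emb_eq hu
    change e (T.system.act g (T.emb χ x)) = T'.system.act g (e (T.emb χ x))
    rw [← emb_act, he', he', twist_act]
  · rw [← T.emb_one, he', twist_one hv1]

end Twist

/-- In the sign convention of `B2`, the cochain with coboundary `ω` is the inverse of the family of
unitaries describing the equivalence. -/
theorem DifferBy.cls_eq_iff (h : T.DifferBy T' ω) {Δ : PontryaginDual Z →* MulAut
    (α.pullback E.q).centralUnitary} (hΔ : ∀ χ, Δ χ = (M χ).frohlich) :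
    T.cls = T'.cls ↔ ω ∈ B2 Δ := by
  rw [mem_B2]
  constructor
  · intro hc
    obtain ⟨e⟩ : Nonempty (GHatStructure.Equivalence T.toGHatStructure T'.toGHatStructure) :=
      Quotient.exact hc
    obtain ⟨v, hv⟩ := h.exists_of_equivalence e
    refine ⟨v⁻¹, fun χ χ' => ?_⟩
    rw [Pi.inv_apply, Pi.inv_apply, Pi.inv_apply, hv, hΔ, map_inv, div_inv_eq_mul]
    rw [mul_comm (v χ), mul_assoc ((M χ).frohlich _), inv_mul_cancel_left, mul_inv_cancel_comm]
  · rintro ⟨w, hw⟩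
    have hv : ∀ χ χ', w⁻¹ (χ * χ') = w⁻¹ χ * (M χ).frohlich (w⁻¹ χ') * ω (χ, χ') := fun χ χ' => by
      rw [← hw, ← hΔ, Pi.inv_apply, Pi.inv_apply, Pi.inv_apply, map_inv,
        div_eq_mul_inv, mul_right_comm (Δ χ (w χ')), ← mul_inv, mul_comm (w χ), inv_mul_cancel_left]
    refine Quotient.sound (h.nonempty_equivalence hv ?_)
    -- Normalisation comes for free: as `ω (1, 1) = 1` and `Δ 1` is the identity, the coboundary
    -- equation at `(1, 1)` reduces to `w 1 = 1`.
    have h1 := hw 1 1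
    rw [h.one_left, map_one, mul_one] at h1
    simpa using h1

end StructureOn

end Classification

end CStarLift

/-! ### The classification theorem -/

theorem mainTheorem6 {Z Gh G : Type*}
    [CommGroup Z] [TopologicalSpace Z] [IsTopologicalGroup Z] [CompactSpace Z] [T2Space Z]
    [Group Gh] [TopologicalSpace Gh] [IsTopologicalGroup Gh] [CompactSpace Gh] [T2Space Gh]
    [Group G] [TopologicalSpace G] [IsTopologicalGroup G] [CompactSpace G] [T2Space G]
    {A : Type u} [CStarAlgebra A]
    (E : CStarLift.CentralExtension Z Gh G)
    (α : CStarLift.CStarSystem G A) (hα : α.IsFree)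
    (p : CStarLift.PicHom (PontryaginDual Z) (α.pullback E.q))
    (hp : (CStarLift.ExtOver p).Nonempty)
    (M : PontryaginDual Z → CStarLift.MoritaSelfEquivalence (α.pullback E.q))
    (hM : ∀ χ, (M χ).cls = p.toFun χ)
    (e₀ : (CStarLift.MoritaSelfEquivalence.unit (α.pullback E.q)).Iso (M 1)) :
    (∀ c, c ∈ CStarLift.ExtOver p ↔ ∃ T : CStarLift.StructureOn M e₀, T.cls = c) ∧
    (∀ T T' : CStarLift.StructureOn M e₀, ∃ ω ∈ CStarLift.Z2 p.frohlich,
      T.DifferBy T' ω ∧ (∀ χ, ω (1, χ) = 1 ∧ ω (χ, 1) = 1) ∧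
        ∀ ω', T.DifferBy T' ω' → ω' = ω) ∧
    (∀ (T T' : CStarLift.StructureOn M e₀) (ω), T.DifferBy T' ω →
      (T.cls = T'.cls ↔ ω ∈ CStarLift.B2 p.frohlich)) := by
  -- The automorphism attached to a Picard class may be computed on any representative, here on `M
  -- χ`.
  have hΔ : ∀ χ, p.frohlich χ = (M χ).frohlich := fun χ => by
    change (p.toFun χ).frohlich = _
    rw [← hM]
    rfl
  refine ⟨CStarLift.mem_extOver_iff hM, fun T T' => ?_, fun T T' ω h => h.cls_eq_iff hΔ⟩
  obtain ⟨ω, h⟩ := T.exists_differBy T'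
  refine ⟨ω, CStarLift.mem_Z2.mpr fun χ χ' χ'' => ?_, h, fun χ => ⟨h.one_left χ, h.one_right χ⟩,
    fun ω' h' => h.unique h'⟩
  rw [hΔ]
  exact h.mul_mul χ χ' χ''
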